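/- **Problems.** A constraint of arity $k$ is a function $f:\{0,1\}^k\to\mathbb{C}$; it is algebraic if all its values are algebraic numbers. Let $\mathcal{U}$ be the set of unary constraints, and $\mathcal{U}\cap NZ$ the set of unary constraints $[a,b]$ with $a\neq0$ and $b\neq 0$ (i.e. those that are not of the form $c\cdot\Delta_0$ or $c\cdot\Delta_1$, where $\Delta_0=[1,0]$, $\Delta_1=[0,1]$ and $c\in\mathbb{C}$). For a set $\mathcal{G}$ of constraints, $\#\mathrm{CSP}_{\mathbb{A}}(\mathcal{G})$ is the following counting problem. An instance $\Omega$ consists of Boolean variables $x_1,\dots,x_n$ and a finite list of nodes $v$, each labelled by an algebraic constraint $f_v\in\mathcal{G}$ of some arity $k_v$ and attached to a sequence $(x_{i_{v,1}},\dots,x_{i_{v,k_v}})$ of variables; its value is $\mathrm{csp}_\Omega=\sum_{\sigma:\{x_1,\dots,x_n\}\to\{0,1\}}\prod_v f_v(\sigma(x_{i_{v,1}}),\dots,\sigma(x_{i_{v,k_v}}))$. For a set $\mathcal{F}$ of constraints, put $\#\mathrm{CSP}^*_{\mathbb{A}}(\mathcal{F})=\#\mathrm{CSP}_{\mathbb{A}}(\mathcal{F}\cup\mathcal{U})$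 and $\#\mathrm{CSP}^+_{\mathbb{A}}(\mathcal{F})=\#\mathrm{CSP}_{\mathbb{A}}(\mathcal{F}\cup(\mathcal{U}\cap NZ))$. **Input format and machines.** Instances are binary strings; constraints are given by their tables of values, variables in unary, and an algebraic number by a straight-line program over $+,-,\times,\div$ whose starting values are roots of integer polynomials (coefficients in binary), each isolated by a rational disc; $|x|$ is the length of the string $x$. Algorithms are randomized programs with stacks of bits and registers holding complex numbers, where complex numbers are basic objects: a stack operation, an arithmetic operation, loading the constant $1$, a comparison of absolute values, a coin toss and an oracle call each cost one step. The error parameter and the answers of oracles are given in registers. **Approximation.** For $\varepsilon\in(0,1)$, $w$ is a $2^{\varepsilon}$-approximate solution for $v\in\mathbb{C}$ if either $v=w=0$, or $v\ne0$, $2^{-\varepsilon}\le|w/v|\le2^{\varepsilon}$ and $|\arg(w/v)|\le\varepsilon$. A randomized approximation scheme for $F$ outputs, on every instance $x$ and every $\varepsilon\in(0,1)$, a $2^{\varepsilon}$-approximate solution for $F(x)$ with probability at least $3/4$. $F$ is AP-reducible to $G$ if there are a randomized oracle program $N$ and polynomials $p,q$ such that, for every randomized approximation scheme $M$ for $G$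 used as oracle (each call returning a fresh random outcome of $M$): (i) $N$ is a randomized approximation scheme for $F$; (ii) every oracle call $(w,\delta)$ of $N$ on input $(x,\varepsilon)$ satisfies $\delta\in(0,1)$ and $1/\delta\le p(|x|,1/\varepsilon)$; (iii) $N$ halts on input $(x,\varepsilon)$ within $q(|x|,1/\varepsilon)$ steps. $F$ and $G$ are AP-equivalent if each is AP-reducible to the other. **Lemma.** For every set $\mathcal{F}$ of (complex-valued, Boolean) constraints, $\#\mathrm{CSP}^*_{\mathbb{A}}(\mathcal{F})$ and $\#\mathrm{CSP}^+_{\mathbb{A}}(\mathcal{F})$ are AP-equivalent. -/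

import Mathlib

/-! ### Constraints and constraint frames -/

/-- A (complex-valued) constraint: an arity `k` together with a function `{0,1}^k → ℂ`. -/
abbrev Constraint : Type := Σ k : ℕ, ((Fin k → Bool) → ℂ)

/-- The set `𝒰` of all unary constraints. -/
def unaryConstraints : Set Constraint := {f | f.1 = 1}

/-- The set `NZ` of all constraints of arity at least one that never take the value `0`. -/
def nonzeroConstraints : Set Constraint := {f | 1 ≤ f.1 ∧ ∀ y, f.2 y ≠ 0}

/-- A constraint frame: a bipartite (multi)graph whose left nodes are the Boolean variables
`x_0, …, x_{n-1}` and whose right nodes `0, …, m-1` are labelled by constraints. The edges at a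
right node `v` are listed in the order of the arguments of its label: the `i`-th one leads to the
variable `inc v i`. -/
structure ConstraintFrame where
  n : ℕ
  m : ℕ
  label : Fin m → Constraint
  inc : ∀ v : Fin m, Fin (label v).1 → Fin n

/-- The value `csp_Ω`: the sum over all variable assignments of the product of the outcomes of
all constraints of the frame. -/
noncomputable def ConstraintFrame.csp (Ω : ConstraintFrame) : ℂ :=
  ∑ σ : Fin Ω.n → Bool, ∏ v : Fin Ω.m, (Ω.label v).2 (fun i => σ (Ω.inc v i))

/-! ### Specifying algebraic numbers by finite strings

A number is specified by a straight-line program over the primitive operations `+, -, *, /`,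
starting from roots of explicitly given integer polynomials. -/

/-- The four primitive arithmetic operations. -/
inductive ArithOp
  | add | sub | mul | div

/-- The operation on complex numbers (division by zero yields `0`). -/
noncomputable def ArithOp.apply : ArithOp → ℂ → ℂ → ℂ
  | .add, x, y => x + y
  | .sub, x, y => x - y
  | .mul, x, y => x * y
  | .div, x, y => x / y

/-- The value at `z` of the integer polynomial with the given coefficients, constant term first. -/
noncomputable def hornerEval (p : List ℤ) (z : ℂ) : ℂ :=
  p.foldr (fun (c : ℤ) (acc : ℂ) => (c : ℂ) + z * acc) 0

/-- One line of a straight-line program. `root p a b d` produces the unique root of `p` in the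
open disc of radius `1/d` around `(a + b i)/d`. `op o i j` applies `o` to the results produced
`i + 1` and `j + 1` lines earlier. -/
inductive Line
  | root (p : List ℤ) (a b : ℤ) (d : ℕ)
  | op (o : ArithOp) (i j : ℕ)

/-- `z` is a root of `p` in the open disc of radius `1/d` around `(a + b i)/d`. -/
def IsRootInDisc (p : List ℤ) (a b : ℤ) (d : ℕ) (z : ℂ) : Prop :=
  hornerEval p z = 0 ∧ ‖z - ((a : ℂ) + (b : ℂ) * Complex.I) / (d : ℂ)‖ < 1 / (d : ℝ)

open Classical in
/-- The result of a line, given the results of the earlier lines (most recent first). A root line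
whose disc does not contain exactly one root, and a reference to a line that does not exist,
stand for `0`. -/
noncomputable def Line.result (env : List ℂ) : Line → ℂ
  | .root p a b d => if h : ∃! z, IsRootInDisc p a b d z then h.choose else 0
  | .op o i j => o.apply (env.getD i 0) (env.getD j 0)

/-- A specification of an algebraic number: a straight-line program, first line first. -/
abbrev NumCode : Type := List Line

/-- The results of all lines of a program, most recent first. -/
noncomputable def NumCode.results (s : NumCode) : List ℂ :=
  s.foldl (fun env l => l.result env :: env) []

/-- The number that is specified: the result of the last line (`0` for the empty program). -/
noncomputable def NumCode.value (s : NumCode) : ℂ := s.results.getD 0 0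

/-! ### Specifying constraint frames by finite strings -/

/-- A right node of a frame with `n` variables: an arity, the incident variables in order, and the
table of values of the constraint. -/
structure NodeCode (n : ℕ) where
  arity : ℕ
  scope : Fin arity → Fin n
  table : (Fin arity → Bool) → NumCode

/-- The constraint that labels a node. -/
noncomputable def NodeCode.constraint {n : ℕ} (v : NodeCode n) : Constraint :=
  ⟨v.arity, fun y => (v.table y).value⟩

/-- A finite description of a constraint frame with algebraic constraints. -/
structure FrameCode where
  n : ℕ
  nodes : List (NodeCode n)

/-- The constraint frame that is described. -/
noncomputable def FrameCode.frame (c : FrameCode) : ConstraintFrame where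
  n := c.n
  m := c.nodes.length
  label v := (c.nodes.get v).constraint
  inc v := (c.nodes.get v).scope

/-- All elements of `{0,1}^k` in lexicographic order. -/
def boolVectors : (k : ℕ) → List (Fin k → Bool)
  | 0 => [Fin.elim0]
  | k + 1 => (boolVectors k).map (Fin.cons false) ++ (boolVectors k).map (Fin.cons true)

/-- Unary code of a natural number. -/
def encUnary (n : ℕ) : List Bool := List.replicate n true ++ [false]

/-- Code of a list: every item is announced by a `1`, the end of the list by a `0`. -/
def encList {α : Type} (enc : α → List Bool) : List α → List Bool
  | [] => [false]
  | a :: l => true :: (enc a ++ encList enc l)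

/-- Binary code of a natural number. -/
def encNat (n : ℕ) : List Bool := encList (fun b => [b]) n.bits

/-- Code of an integer: a sign and the absolute value in binary. -/
def encInt (z : ℤ) : List Bool := decide (z < 0) :: encNat z.natAbs

def encArithOp : ArithOp → List Bool
  | .add => [false, false]
  | .sub => [false, true]
  | .mul => [true, false]
  | .div => [true, true]

def encLine : Line → List Bool
  | .root p a b d => false :: (encList encInt p ++ (encInt a ++ (encInt b ++ encNat d)))
  | .op o i j => true :: (encArithOp o ++ (encUnary i ++ encUnary j))

def encNum (s : NumCode) : List Bool := encList encLine s

def encNode {n : ℕ} (v : NodeCode n) : List Bool :=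
  encList (fun i : Fin n => encUnary i) (List.ofFn v.scope) ++
    encList encNum ((boolVectors v.arity).map v.table)

def encFrame (c : FrameCode) : List Bool := encUnary c.n ++ encList encNode c.nodes

/-! ### The code determines the frame description -/

/-- No code word is a proper prefix of another one, and code words determine what they encode. -/
def PrefixCode {α : Type} (enc : α → List Bool) : Prop :=
  ∀ a b r s, enc a ++ r = enc b ++ s → a = b ∧ r = s

theorem prefixCode_encUnary : PrefixCode encUnary := by
  intro a
  induction a with
  | zero =>
    intro b r s h
    cases b with
    | zero => simpa [encUnary] using h
    | succ b => simp [encUnary, List.replicate_succ] at h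
  | succ a ih =>
    intro b r s h
    cases b with
    | zero => simp [encUnary, List.replicate_succ] at h
    | succ b =>
      have h' : encUnary a ++ r = encUnary b ++ s := by
        simpa [encUnary, List.replicate_succ] using h
      obtain ⟨h1, h2⟩ := ih b r s h'
      exact ⟨by rw [h1], h2⟩

theorem prefixCode_encList {α : Type} {enc : α → List Bool} (he : PrefixCode enc) :
    PrefixCode (encList enc) := by
  intro l
  induction l with
  | nil =>
    intro l' r s h
    cases l' with
    | nil => simpa [encList] using h
    | cons b l' => simp [encList] at h
  | cons a l ih =>
    intro l' r s h
    cases l' with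
    | nil => simp [encList] at h
    | cons b l' =>
      have h' : enc a ++ (encList enc l ++ r) = enc b ++ (encList enc l' ++ s) := by
        simpa [encList] using h
      obtain ⟨h1, h2⟩ := he _ _ _ _ h'
      obtain ⟨h3, h4⟩ := ih _ _ _ h2
      exact ⟨by rw [h1, h3], h4⟩

theorem prefixCode_encNat : PrefixCode encNat := by
  intro a b r s h
  have hb : PrefixCode (fun b : Bool => [b]) := by
    intro a b r s h
    simpa using h
  obtain ⟨h1, h2⟩ := prefixCode_encList hb _ _ _ _ h
  refine ⟨?_, h2⟩
  have hinj : ∀ n : ℕ, n.bits.foldr (fun b k => Nat.bit b k) 0 = n := by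
    intro n
    induction n using Nat.binaryRec' with
    | zero => simp
    | bit b n hn ih => rw [Nat.bits_append_bit n b hn, List.foldr_cons, ih]
  rw [← hinj a, ← hinj b, h1]

theorem prefixCode_encInt : PrefixCode encInt := by
  intro a b r s h
  have h' : decide (a < 0) = decide (b < 0) ∧
      encNat a.natAbs ++ r = encNat b.natAbs ++ s := by simpa [encInt] using h
  obtain ⟨h1, h2⟩ := prefixCode_encNat _ _ _ _ h'.2
  have h3 : a < 0 ↔ b < 0 := by simpa using h'.1
  exact ⟨by omega, h2⟩

theorem prefixCode_encLine : PrefixCode encLine := by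
  intro x y r s h
  cases x with
  | root p a b d =>
    cases y with
    | root p' a' b' d' =>
      simp only [encLine, List.cons_append, List.append_assoc, List.cons.injEq, true_and] at h
      obtain ⟨h1, h⟩ := prefixCode_encList prefixCode_encInt _ _ _ _ h
      obtain ⟨h2, h⟩ := prefixCode_encInt _ _ _ _ h
      obtain ⟨h3, h⟩ := prefixCode_encInt _ _ _ _ h
      obtain ⟨h4, h⟩ := prefixCode_encNat _ _ _ _ h
      exact ⟨by rw [h1, h2, h3, h4], h⟩
    | op o i j => simp [encLine] at h
  | op o i j =>
    cases y with
    | root p' a' b' d' => simp [encLine] at h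
    | op o' i' j' =>
      simp only [encLine, List.cons_append, List.append_assoc, List.cons.injEq, true_and] at h
      have ho : o = o' ∧ encUnary i ++ (encUnary j ++ r) = encUnary i' ++ (encUnary j' ++ s) := by
        cases o <;> cases o' <;> simp [encArithOp] at h <;> exact ⟨rfl, h⟩
      obtain ⟨h1, h⟩ := ho
      obtain ⟨h2, h⟩ := prefixCode_encUnary _ _ _ _ h
      obtain ⟨h3, h⟩ := prefixCode_encUnary _ _ _ _ h
      exact ⟨by rw [h1, h2, h3], h⟩

theorem mem_boolVectors : ∀ {k : ℕ} (y : Fin k → Bool), y ∈ boolVectors k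
  | 0, y => by simp [boolVectors, Subsingleton.elim y Fin.elim0]
  | k + 1, y => by
    have h := mem_boolVectors (Fin.tail y)
    have hy : Fin.cons (y 0) (Fin.tail y) = y := Fin.cons_self_tail y
    cases h0 : y 0 with
    | false =>
      rw [h0] at hy
      exact List.mem_append_left _ (List.mem_map.2 ⟨_, h, hy⟩)
    | true =>
      rw [h0] at hy
      exact List.mem_append_right _ (List.mem_map.2 ⟨_, h, hy⟩)

theorem prefixCode_encNode {n : ℕ} : PrefixCode (encNode (n := n)) := by
  intro v w r s h
  have hf : PrefixCode (fun i : Fin n => encUnary i) := by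
    intro a b r s h
    obtain ⟨h1, h2⟩ := prefixCode_encUnary _ _ _ _ h
    exact ⟨Fin.ext h1, h2⟩
  simp only [encNode, List.append_assoc] at h
  obtain ⟨h1, h⟩ := prefixCode_encList hf _ _ _ _ h
  obtain ⟨k, sc, t⟩ := v
  obtain ⟨k', sc', t'⟩ := w
  have hk : k = k' := by simpa using congrArg List.length h1
  subst hk
  obtain ⟨h2, h⟩ := prefixCode_encList (prefixCode_encList prefixCode_encLine) _ _ _ _ h
  have hsc : sc = sc' := List.ofFn_injective h1
  have ht : t = t' := by
    funext y
    exact List.map_inj_left.1 h2 y (mem_boolVectors y)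
  rw [hsc, ht]
  exact ⟨rfl, h⟩

theorem encFrame_injective : Function.Injective encFrame := by
  rintro ⟨n, l⟩ ⟨n', l'⟩ h
  obtain ⟨h1, h2⟩ := prefixCode_encUnary _ _ _ _ h
  simp only at h1
  subst h1
  have h3 : encList encNode l ++ [] = encList encNode l' ++ [] := by simpa using h2
  obtain ⟨h4, -⟩ := prefixCode_encList prefixCode_encNode _ _ _ _ h3
  rw [h4]

/-! ### The specified numbers are exactly the algebraic numbers -/

theorem exists_poly_hornerEval (p : List ℤ) :
    ∃ P : Polynomial ℤ, ∀ z : ℂ, Polynomial.aeval z P = hornerEval p z := by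
  induction p with
  | nil => exact ⟨0, fun z => by simp [hornerEval]⟩
  | cons c p ih =>
    obtain ⟨P, hP⟩ := ih
    exact ⟨Polynomial.C c + Polynomial.X * P, fun z => by simp [hornerEval, hP]⟩

theorem exists_hornerEval_poly (P : Polynomial ℤ) :
    ∃ p : List ℤ, ∀ z : ℂ, hornerEval p z = Polynomial.aeval z P := by
  suffices h : ∀ n : ℕ, ∀ P : Polynomial ℤ, P.natDegree < n →
      ∃ p : List ℤ, ∀ z : ℂ, hornerEval p z = Polynomial.aeval z P from h _ P (Nat.lt_succ_self _)
  intro n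
  induction n with
  | zero => intro P h; omega
  | succ n ih =>
    intro P h
    rcases Nat.eq_zero_or_pos P.natDegree with h0 | h0
    · refine ⟨[P.coeff 0], fun z => ?_⟩
      conv_rhs => rw [Polynomial.eq_C_of_natDegree_eq_zero h0]
      simp [hornerEval]
    · obtain ⟨p, hp⟩ := ih P.divX (by rw [Polynomial.natDegree_divX_eq_natDegree_tsub_one]; omega)
      refine ⟨P.coeff 0 :: p, fun z => ?_⟩
      conv_rhs => rw [← Polynomial.X_mul_divX_add P]
      rw [hornerEval, List.foldr_cons]
      change (P.coeff 0 : ℂ) + z * hornerEval p z = _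
      rw [hp]
      simp [add_comm]

theorem isAlgebraic_of_existsUnique_root {p : List ℤ} {a b : ℤ} {d : ℕ} {z : ℂ}
    (hz : IsRootInDisc p a b d z) (hu : ∀ w, IsRootInDisc p a b d w → w = z) :
    IsAlgebraic ℚ z := by
  obtain ⟨P, hP⟩ := exists_poly_hornerEval p
  by_cases h0 : P = 0
  · exfalso
    set c : ℂ := ((a : ℂ) + (b : ℂ) * Complex.I) / (d : ℂ) with hc
    have hroot : ∀ w, hornerEval p w = 0 := fun w => by rw [← hP, h0]; simp
    have hr : (0 : ℝ) < 1 / (d : ℝ) := lt_of_le_of_lt (norm_nonneg _) hz.2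
    have h1 : c = z := hu c ⟨hroot _, by rw [← hc, sub_self, norm_zero]; exact hr⟩
    have h2 : c + ((1 / (d : ℝ) / 2 : ℝ) : ℂ) = z := by
      refine hu _ ⟨hroot _, ?_⟩
      rw [← hc, add_sub_cancel_left, Complex.norm_real, Real.norm_of_nonneg (by positivity)]
      linarith
    have h3 : ((1 / (d : ℝ) / 2 : ℝ) : ℂ) = 0 := by
      rw [← h1] at h2
      simpa using h2
    rw [Complex.ofReal_eq_zero] at h3
    linarith
  · have : IsAlgebraic ℤ z := ⟨P, h0, by rw [hP]; exact hz.1⟩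
    exact (IsFractionRing.isAlgebraic_iff ℤ ℚ ℂ).1 this

theorem Line.isAlgebraic_result (l : Line) (env : List ℂ) (h : ∀ z ∈ env, IsAlgebraic ℚ z) :
    IsAlgebraic ℚ (l.result env) := by
  have hget : ∀ i, IsAlgebraic ℚ (env.getD i 0) := by
    intro i
    by_cases hi : i < env.length
    · rw [List.getD_eq_getElem _ _ hi]; exact h _ (List.getElem_mem hi)
    · rw [List.getD_eq_default _ _ (by omega)]; exact isAlgebraic_zero
  cases l with
  | root p a b d =>
    rw [Line.result]
    split_ifs with hu
    · exact isAlgebraic_of_existsUnique_root hu.choose_spec.1 hu.choose_spec.2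
    · exact isAlgebraic_zero
  | op o i j =>
    cases o
    · exact (hget i).add (hget j)
    · exact (hget i).sub (hget j)
    · exact (hget i).mul (hget j)
    · change IsAlgebraic ℚ (env.getD i 0 / env.getD j 0)
      rw [div_eq_mul_inv]
      exact (hget i).mul (hget j).inv

theorem NumCode.exists_value_eq_iff (z : ℂ) :
    (∃ s : NumCode, s.value = z) ↔ IsAlgebraic ℚ z := by
  constructor
  · rintro ⟨s, rfl⟩
    have h : ∀ (s : NumCode) (env : List ℂ), (∀ z ∈ env, IsAlgebraic ℚ z) →
        ∀ z ∈ s.foldl (fun env l => l.result env :: env) env, IsAlgebraic ℚ z := by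
      intro s
      induction s with
      | nil => intro env h; simpa using h
      | cons l s ih =>
        intro env h
        refine ih _ ?_
        intro z hz
        rcases List.mem_cons.1 hz with rfl | hz
        · exact l.isAlgebraic_result env h
        · exact h z hz
    unfold NumCode.value
    have h' := h s [] (by simp)
    change ∀ z ∈ s.results, IsAlgebraic ℚ z at h'
    cases hs : s.results with
    | nil => exact isAlgebraic_zero
    | cons w ws => exact h' w (by rw [hs]; simp)
  · intro hz
    obtain ⟨P, hP0, hPz⟩ := (IsFractionRing.isAlgebraic_iff ℤ ℚ ℂ).2 hz
    obtain ⟨p, hp⟩ := exists_hornerEval_poly P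
    have hfin : {w : ℂ | Polynomial.aeval w P = 0}.Finite := by
      refine (P.rootSet_finite ℂ).subset fun w hw => ?_
      exact (Polynomial.mem_rootSet).2 ⟨hP0, hw⟩
    have hopen : ∀ᶠ w in nhds z, w ∉ {w : ℂ | Polynomial.aeval w P = 0} \ {z} :=
      (hfin.subset Set.sdiff_subset).isClosed.isOpen_compl.mem_nhds (by simp)
    obtain ⟨r, hr, hball⟩ := Metric.eventually_nhds_iff.1 hopen
    obtain ⟨d, hd⟩ := exists_nat_gt (2 / r)
    have hd0 : (0 : ℝ) < d := lt_trans (by positivity) hd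
    have hdr : 2 / (d : ℝ) < r := by
      rw [div_lt_iff₀ hr] at hd
      rw [div_lt_iff₀ hd0]
      linarith
    have hdC : (d : ℂ) ≠ 0 := by exact_mod_cast hd0.ne'
    set a : ℤ := round (d * z.re) with ha
    set b : ℤ := round (d * z.im) with hb
    have hc : ‖z - ((a : ℂ) + (b : ℂ) * Complex.I) / (d : ℂ)‖ < 1 / (d : ℝ) := by
      have h1 : z - ((a : ℂ) + (b : ℂ) * Complex.I) / (d : ℂ) =
          (d * z - ((a : ℂ) + (b : ℂ) * Complex.I)) / (d : ℂ) := by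
        field_simp
      rw [h1, norm_div, Complex.norm_natCast]
      refine div_lt_div_of_pos_right ?_ hd0
      have hx : |d * z.re - a| ≤ 1 / 2 := abs_sub_round _
      have hy : |d * z.im - b| ≤ 1 / 2 := abs_sub_round _
      have hx2 := sq_le_sq' (by linarith [(abs_le.1 hx).1]) (abs_le.1 hx).2
      have hy2 := sq_le_sq' (by linarith [(abs_le.1 hy).1]) (abs_le.1 hy).2
      have hn : ‖(d * z - ((a : ℂ) + (b : ℂ) * Complex.I))‖ ^ 2 < 1 ^ 2 := by
        rw [← Complex.normSq_eq_norm_sq, Complex.normSq_apply]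
        simp
        nlinarith
      exact lt_of_pow_lt_pow_left₀ 2 (by norm_num) hn
    have hzr : IsRootInDisc p a b d z := ⟨by rw [hp]; exact hPz, hc⟩
    have huniq : ∀ w, IsRootInDisc p a b d w → w = z := by
      intro w hw
      by_contra hne
      refine hball (y := w) ?_ ⟨by rw [Set.mem_ofPred_eq, ← hp]; exact hw.1, hne⟩
      have := dist_triangle_right w z (((a : ℂ) + (b : ℂ) * Complex.I) / (d : ℂ))
      rw [dist_eq_norm w (_ / _), dist_eq_norm z (_ / _)] at this
      have h2 : 1 / (d : ℝ) + 1 / (d : ℝ) = 2 / (d : ℝ) := by ring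
      linarith [hw.2]
    have hex : ∃! w, IsRootInDisc p a b d w := ⟨z, hzr, huniq⟩
    refine ⟨[Line.root p a b d], ?_⟩
    change Line.result [] (Line.root p a b d) = z
    rw [Line.result, dif_pos hex]
    exact huniq _ hex.choose_spec.1

/-! ### Counting problems -/

/-- A complex-valued counting problem: its instances are given as strings over `{0,1}`. -/
structure CountingProblem where
  Inst : Type
  encode : Inst → List Bool
  encode_injective : Function.Injective encode
  value : Inst → ℂ

/-- `#CSP_𝔸(𝒢)`: the instances are the constraint frames all of whose labels are algebraic
constraints in `𝒢`, and the value of an instance `Ω` is `csp_Ω`. -/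
noncomputable def sharpCSPAlg (G : Set Constraint) : CountingProblem where
  Inst := {c : FrameCode // ∀ v ∈ c.nodes, v.constraint ∈ G}
  encode c := encFrame c.1
  encode_injective _ _ h := Subtype.ext (encFrame_injective h)
  value c := c.1.frame.csp

/-- `#CSP*_𝔸(ℱ) = #CSP_𝔸(ℱ, 𝒰)`. -/
noncomputable def sharpCSPStarAlg (F : Set Constraint) : CountingProblem :=
  sharpCSPAlg (F ∪ unaryConstraints)

/-- `#CSP⁺_𝔸(ℱ) = #CSP_𝔸(ℱ, 𝒰 ∩ NZ)`. -/
noncomputable def sharpCSPPlusAlg (F : Set Constraint) : CountingProblem :=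
  sharpCSPAlg (F ∪ (unaryConstraints ∩ nonzeroConstraints))

/-! ### Randomized approximation schemes -/

/-- `w` is a `2^ε`-approximate solution for the value `v`. -/
def IsApproxSolution (ε : ℝ) (v w : ℂ) : Prop :=
  (v = 0 → w = 0) ∧
  (v ≠ 0 → (2 : ℝ) ^ (-ε) ≤ ‖w / v‖ ∧ ‖w / v‖ ≤ (2 : ℝ) ^ ε ∧ |(w / v).arg| ≤ ε)

/-- The input-output behaviour of a randomized algorithm: on a string and an error tolerance
parameter it outputs a random complex number. -/
abbrev RandomizedMap : Type := List Bool → ℝ → PMF ℂ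

/-- `M` is a randomized approximation scheme for `F`. -/
def IsApproxScheme (F : CountingProblem) (M : RandomizedMap) : Prop :=
  ∀ (x : F.Inst) (ε : ℝ), 0 < ε → ε < 1 →
    3 / 4 ≤ (M (F.encode x) ε).toOuterMeasure {w | IsApproxSolution ε (F.value x) w}

/-! ### Randomized oracle machines

A machine has finitely many stacks of bits and finitely many registers for complex numbers (those
that occur in its program). Complex numbers are basic objects: a primitive operation or a
comparison of absolute values takes one step, as does every stack operation, every coin toss and
every oracle call. -/

/-- Tests: is stack `i` empty; is `b` on top of stack `i`; is the number in register `i` smaller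
in absolute value than the one in register `j`; does a fair coin show heads. -/
inductive Test
  | isEmpty (i : ℕ)
  | topIs (i : ℕ) (b : Bool)
  | absLt (i j : ℕ)
  | coin

/-- Programs. `query i j k` calls the oracle on the contents of stack `i` (top first) with the
error tolerance in register `j`, and stores the answer in register `k`. -/
inductive Prog
  | push (i : ℕ) (b : Bool)
  | pop (i : ℕ)
  | setOne (k : ℕ)
  | arith (o : ArithOp) (i j k : ℕ)
  | query (i j k : ℕ)
  | seq (p q : Prog)
  | ite (t : Test) (p q : Prog)
  | loop (t : Test) (p : Prog)

/-- A configuration: what remains to be executed, the stacks, the registers, and a record of all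
oracle calls made so far. -/
structure Config where
  todo : List Prog
  stack : ℕ → List Bool
  regs : ℕ → ℂ
  calls : List (List Bool × ℂ)

open Classical in
/-- The random outcome of a test. -/
noncomputable def Test.eval (c : Config) : Test → PMF Bool
  | .isEmpty i => PMF.pure (decide (c.stack i = []))
  | .topIs i b => PMF.pure (decide ((c.stack i).head? = some b))
  | .absLt i j => PMF.pure (decide (‖c.regs i‖ < ‖c.regs j‖))
  | .coin => PMF.uniformOfFintype Bool

/-- One step of the machine with oracle `M`; a halted configuration (nothing to be executed) does
not change any more. Every oracle call draws a fresh independent answer. -/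
noncomputable def Config.step (M : RandomizedMap) (c : Config) : PMF Config :=
  match c.todo with
  | [] => PMF.pure c
  | .push i b :: K =>
      PMF.pure { c with todo := K, stack := Function.update c.stack i (b :: c.stack i) }
  | .pop i :: K =>
      PMF.pure { c with todo := K, stack := Function.update c.stack i (c.stack i).tail }
  | .setOne k :: K => PMF.pure { c with todo := K, regs := Function.update c.regs k 1 }
  | .arith o i j k :: K =>
      PMF.pure
        { c with todo := K, regs := Function.update c.regs k (o.apply (c.regs i) (c.regs j)) }
  | .query i j k :: K =>
      (M (c.stack i) (c.regs j).re).map fun z =>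
        { c with
          todo := K
          regs := Function.update c.regs k z
          calls := (c.stack i, c.regs j) :: c.calls }
  | .seq p q :: K => PMF.pure { c with todo := p :: q :: K }
  | .ite t p q :: K => (t.eval c).map fun b => { c with todo := (if b then p else q) :: K }
  | .loop t p :: K =>
      (t.eval c).map fun b => { c with todo := if b then p :: .loop t p :: K else K }

/-- The distribution of the configuration after the given number of steps. -/
noncomputable def Config.run (M : RandomizedMap) : ℕ → Config → PMF Config
  | 0, c => PMF.pure c
  | n + 1, c => (c.step M).bind (Config.run M n)

/-- The initial configuration on input `(x, ε)`: `x` on stack `0`, `ε` in register `0`. -/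
noncomputable def Prog.init (N : Prog) (x : List Bool) (ε : ℝ) : Config where
  todo := [N]
  stack := Function.update (fun _ => []) 0 x
  regs := Function.update (fun _ => 0) 0 (ε : ℂ)
  calls := []

/-- The output of a halted machine is the content of register `0`. -/
def Config.output (c : Config) : ℂ := c.regs 0

/-- The value `p(n, 1/ε)` of a polynomial in two variables. -/
noncomputable def polyBound (p : MvPolynomial (Fin 2) ℝ) (n : ℕ) (ε : ℝ) : ℝ :=
  MvPolynomial.eval ![(n : ℝ), 1 / ε] p

/-- `F` is AP-reducible to `G`: there are an oracle machine `N` and polynomials `p, q` such that,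
with any randomized approximation scheme `M` for `G` as oracle, `N` halts within `q(|x|, 1/ε)`
steps on every computation path, every oracle call `(w, δ)` on it has `δ ∈ (0,1)` and
`1/δ ≤ p(|x|, 1/ε)`, and `N` is a randomized approximation scheme for `F`. -/
def APReducible (F G : CountingProblem) : Prop :=
  ∃ (N : Prog) (p q : MvPolynomial (Fin 2) ℝ), ∀ M : RandomizedMap, IsApproxScheme G M →
    IsApproxScheme F (fun x ε =>
      ((N.init x ε).run M ⌊polyBound q x.length ε⌋₊).map Config.output) ∧
    ∀ (x : F.Inst) (ε : ℝ), 0 < ε → ε < 1 →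
      ∀ c ∈ ((N.init (F.encode x) ε).run M ⌊polyBound q (F.encode x).length ε⌋₊).support,
        c.todo = [] ∧
        ∀ call ∈ c.calls, ∃ δ : ℝ, call.2 = (δ : ℂ) ∧ 0 < δ ∧ δ < 1 ∧
          1 / δ ≤ polyBound p (F.encode x).length ε

/-- `F` and `G` are AP-equivalent. -/
def APEquivalent (F G : CountingProblem) : Prop := APReducible F G ∧ APReducible G F

/-! One direction is an inclusion: every instance of `sharpCSPPlusAlg F` is an instance of
`sharpCSPStarAlg F`, so the oracle is asked about the input itself.

For the other direction let Z be the value of an instance whose code has length ℓ. Add r =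
(1/4)^(2^N) to both values of every unary constraint, and let Z' be the new value. The machine asks
for a 2^(ε/2)-approximation w of Z' and outputs w, or 0 if |w| < T = (1/2)^(2^N); note that r = T².

The choice of N rests on a gap principle: the nonzero numbers involved cannot be too small.
Straight-line programs of total length ℓ produce fractions of algebraic integers with conjugates at
most 2^(2^ℓ), inside one number field of degree at most 2^ℓ. The norm of a nonzero algebraic integer
is a nonzero integer (`two_pow_le_norm_mul`). Hence Z and all table values, unless zero, are at
least 1/W in absolute value, where W = 2^(2^(4ℓ+1)), while |Z' - Z| ≤ T²W
(`FrameCode.perturb_bounds`). Taking N = k + 8 + 8ℓ with (1/2)^(2^k) ≤ ε/2 gives 8TW² ≤ ε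
(`half_pow_mul_le`). Consequently no perturbed unary value vanishes, and `isApproxSolution_cutoff`
applies: if Z = 0 then |w| ≤ 2T²W < T, and if Z ≠ 0 then Z' has relative error at most ε/8 and |w| ≥
|Z|/2 ≥ T.

Although r is doubly exponentially small, it has a short program: N squarings of 1/4, with N linear
in ℓ and 1/ε. Therefore the code of the perturbed instance can be written in polynomial time. This
is proved with exact step counts (`Runs`) and a composable notion of rewriting at bounded cost per
input bit (`Rewrites`). N is stored as tokens on a stack, and T is computed in a register alongside.
-/

/-! ### Deterministic computations -/

/-- The memory of a machine. -/
structure Memory where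
  stack : ℕ → List Bool
  regs : ℕ → ℂ

/-- The program `p` leads from the memory `S` to the memory `S'` in exactly `t` steps, without
calling the oracle and whatever remains to be executed afterwards. -/
def Runs (p : Prog) (S S' : Memory) (t : ℕ) : Prop :=
  ∀ (M : RandomizedMap) (K : List Prog) (calls : List (List Bool × ℂ)) (n : ℕ),
    Config.run M (t + n) ⟨p :: K, S.stack, S.regs, calls⟩ =
      Config.run M n ⟨K, S'.stack, S'.regs, calls⟩

/-- In the memory `S` the test `t` has the outcome `b` for certain. -/
def Test.Yields (t : Test) (S : Memory) (b : Bool) : Prop :=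
  ∀ K calls, t.eval ⟨K, S.stack, S.regs, calls⟩ = PMF.pure b

theorem Config.run_succ_of_step {M : RandomizedMap} {c c' : Config}
    (h : c.step M = PMF.pure c') (n : ℕ) : Config.run M (1 + n) c = Config.run M n c' := by
  rw [add_comm, Config.run, h, PMF.pure_bind]

/-- A reduction is observed after exactly the number of steps given by its polynomial bound; surplus
steps are harmless. -/
theorem Config.run_halted (M : RandomizedMap) (c : Config) (h : c.todo = []) (n : ℕ) :
    Config.run M n c = PMF.pure c := by
  induction n with
  | zero => rfl
  | succ n ih =>
    rw [add_comm, Config.run_succ_of_step (c' := c) _ n, ih]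
    unfold Config.step
    rw [h]

/-! ### Step counts of instructions and control structures. -/

theorem runs_push (i : ℕ) (b : Bool) (s : ℕ → List Bool) (r : ℕ → ℂ) :
    Runs (.push i b) ⟨s, r⟩ ⟨Function.update s i (b :: s i), r⟩ 1 :=
  fun _ _ _ n => Config.run_succ_of_step rfl n

theorem runs_pop (i : ℕ) (s : ℕ → List Bool) (r : ℕ → ℂ) :
    Runs (.pop i) ⟨s, r⟩ ⟨Function.update s i (s i).tail, r⟩ 1 :=
  fun _ _ _ n => Config.run_succ_of_step rfl n

theorem runs_setOne (k : ℕ) (s : ℕ → List Bool) (r : ℕ → ℂ) :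
    Runs (.setOne k) ⟨s, r⟩ ⟨s, Function.update r k 1⟩ 1 :=
  fun _ _ _ n => Config.run_succ_of_step rfl n

theorem runs_arith (o : ArithOp) (i j k : ℕ) (s : ℕ → List Bool) (r : ℕ → ℂ) :
    Runs (.arith o i j k) ⟨s, r⟩ ⟨s, Function.update r k (o.apply (r i) (r j))⟩ 1 :=
  fun _ _ _ n => Config.run_succ_of_step rfl n

theorem Runs.seq {p q : Prog} {S S' S'' : Memory} {t u : ℕ} (hp : Runs p S S' t)
    (hq : Runs q S' S'' u) : Runs (.seq p q) S S'' (1 + (t + u)) := by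
  intro M K calls n
  rw [add_assoc, Config.run_succ_of_step (c' := ⟨p :: q :: K, S.stack, S.regs, calls⟩) rfl,
    add_assoc, hp, hq]

theorem Runs.ite_true {c : Test} {p q : Prog} {S S' : Memory} {t : ℕ} (hc : c.Yields S true)
    (hp : Runs p S S' t) : Runs (.ite c p q) S S' (1 + t) := by
  intro M K calls n
  rw [add_assoc, Config.run_succ_of_step (c' := ⟨p :: K, S.stack, S.regs, calls⟩), hp]
  simp only [Config.step]
  rw [hc _ _, PMF.pure_map]
  rfl

theorem Runs.ite_false {c : Test} {p q : Prog} {S S' : Memory} {t : ℕ} (hc : c.Yields S false)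
    (hq : Runs q S S' t) : Runs (.ite c p q) S S' (1 + t) := by
  intro M K calls n
  rw [add_assoc, Config.run_succ_of_step (c' := ⟨q :: K, S.stack, S.regs, calls⟩), hq]
  simp only [Config.step]
  rw [hc _ _, PMF.pure_map]
  rfl

theorem runs_loop_false {c : Test} {p : Prog} {S : Memory} (hc : c.Yields S false) :
    Runs (.loop c p) S S 1 := by
  intro M K calls n
  rw [Config.run_succ_of_step (c' := ⟨K, S.stack, S.regs, calls⟩)]
  simp only [Config.step]
  rw [hc _ _, PMF.pure_map]
  rfl

theorem Runs.loop_true {c : Test} {p : Prog} {S S' S'' : Memory} {t u : ℕ}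
    (hc : c.Yields S true) (hp : Runs p S S' t) (hl : Runs (.loop c p) S' S'' u) :
    Runs (.loop c p) S S'' (1 + (t + u)) := by
  intro M K calls n
  rw [add_assoc,
    Config.run_succ_of_step (c' := ⟨p :: .loop c p :: K, S.stack, S.regs, calls⟩),
    add_assoc, hp, hl]
  simp only [Config.step]
  rw [hc _ _, PMF.pure_map]
  rfl

theorem run_query (M : RandomizedMap) (i j k : ℕ) (K : List Prog) (s : ℕ → List Bool)
    (r : ℕ → ℂ) (calls : List (List Bool × ℂ)) (n : ℕ) :
    Config.run M (1 + n) ⟨.query i j k :: K, s, r, calls⟩ =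
      (M (s i) (r j).re).bind fun z =>
        Config.run M n ⟨K, s, Function.update r k z, (s i, r j) :: calls⟩ := by
  rw [add_comm, Config.run]
  simp only [Config.step]
  rw [PMF.bind_map]
  rfl

/-! ### Memories with five stacks and five registers -/

/-- The first five stacks are as given, the others are empty. -/
def fiveStacks (a b c d e : List Bool) : ℕ → List Bool
  | 0 => a | 1 => b | 2 => c | 3 => d | 4 => e | _ => []

/-- The first five registers are as given, the others contain `0`. -/
def fiveRegs (a b c d e : ℂ) : ℕ → ℂ
  | 0 => a | 1 => b | 2 => c | 3 => d | 4 => e | _ => 0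

section Updates

variable (a b c d e f : List Bool)

@[simp] theorem update_fiveStacks_zero :
    Function.update (fiveStacks a b c d e) 0 f = fiveStacks f b c d e := by
  funext i; rcases i with _ | _ | _ | _ | _ | _ <;> simp [Function.update, fiveStacks]

@[simp] theorem update_fiveStacks_one :
    Function.update (fiveStacks a b c d e) 1 f = fiveStacks a f c d e := by
  funext i; rcases i with _ | _ | _ | _ | _ | _ <;> simp [Function.update, fiveStacks]

@[simp] theorem update_fiveStacks_two :
    Function.update (fiveStacks a b c d e) 2 f = fiveStacks a b f d e := by
  funext i; rcases i with _ | _ | _ | _ | _ | _ <;> simp [Function.update, fiveStacks]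

@[simp] theorem update_fiveStacks_three :
    Function.update (fiveStacks a b c d e) 3 f = fiveStacks a b c f e := by
  funext i; rcases i with _ | _ | _ | _ | _ | _ <;> simp [Function.update, fiveStacks]

@[simp] theorem update_fiveStacks_four :
    Function.update (fiveStacks a b c d e) 4 f = fiveStacks a b c d f := by
  funext i; rcases i with _ | _ | _ | _ | _ | _ <;> simp [Function.update, fiveStacks]

-- Stack 5 always stays empty, so `pop 5` serves as a no-op costing one step.
@[simp] theorem update_fiveStacks_five :
    Function.update (fiveStacks a b c d e) 5 [] = fiveStacks a b c d e := by
  funext i; rcases i with _ | _ | _ | _ | _ | _ | _ <;> simp [Function.update, fiveStacks]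

@[simp] theorem fiveStacks_zero : fiveStacks a b c d e 0 = a := rfl
@[simp] theorem fiveStacks_one : fiveStacks a b c d e 1 = b := rfl
@[simp] theorem fiveStacks_two : fiveStacks a b c d e 2 = c := rfl
@[simp] theorem fiveStacks_three : fiveStacks a b c d e 3 = d := rfl
@[simp] theorem fiveStacks_four : fiveStacks a b c d e 4 = e := rfl
@[simp] theorem fiveStacks_five : fiveStacks a b c d e 5 = [] := rfl

end Updates

section Updates

variable (a b c d e z : ℂ)

@[simp] theorem update_fiveRegs_zero :
    Function.update (fiveRegs a b c d e) 0 z = fiveRegs z b c d e := by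
  funext i; rcases i with _ | _ | _ | _ | _ | _ <;> simp [Function.update, fiveRegs]

@[simp] theorem update_fiveRegs_one :
    Function.update (fiveRegs a b c d e) 1 z = fiveRegs a z c d e := by
  funext i; rcases i with _ | _ | _ | _ | _ | _ <;> simp [Function.update, fiveRegs]

@[simp] theorem update_fiveRegs_two :
    Function.update (fiveRegs a b c d e) 2 z = fiveRegs a b z d e := by
  funext i; rcases i with _ | _ | _ | _ | _ | _ <;> simp [Function.update, fiveRegs]

@[simp] theorem update_fiveRegs_three :
    Function.update (fiveRegs a b c d e) 3 z = fiveRegs a b c z e := by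
  funext i; rcases i with _ | _ | _ | _ | _ | _ <;> simp [Function.update, fiveRegs]

@[simp] theorem update_fiveRegs_four :
    Function.update (fiveRegs a b c d e) 4 z = fiveRegs a b c d z := by
  funext i; rcases i with _ | _ | _ | _ | _ | _ <;> simp [Function.update, fiveRegs]

@[simp] theorem fiveRegs_zero : fiveRegs a b c d e 0 = a := rfl
@[simp] theorem fiveRegs_one : fiveRegs a b c d e 1 = b := rfl
@[simp] theorem fiveRegs_two : fiveRegs a b c d e 2 = c := rfl
@[simp] theorem fiveRegs_three : fiveRegs a b c d e 3 = d := rfl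
@[simp] theorem fiveRegs_four : fiveRegs a b c d e 4 = e := rfl

end Updates

/-! ### Adjusting runs, and tests with a certain outcome. -/

theorem Runs.cast {p : Prog} {S S' T T' : Memory} {t u : ℕ} (h : Runs p S S' t) (hS : S = T)
    (hS' : S' = T') (ht : t = u) : Runs p T T' u := by
  subst hS hS' ht; exact h

theorem yields_topIs {i : ℕ} {b c : Bool} {S : Memory} {w : List Bool}
    (h : S.stack i = c :: w) : (Test.topIs i b).Yields S (c == b) := by
  intro K calls
  simp only [Test.eval, h, List.head?_cons, Option.some.injEq]
  congr 1

theorem yields_topIs_nil {i : ℕ} {b : Bool} {S : Memory} (h : S.stack i = []) :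
    (Test.topIs i b).Yields S false := by
  intro K calls
  simp [Test.eval, h]

theorem yields_isEmpty_nil {i : ℕ} {S : Memory} (h : S.stack i = []) :
    (Test.isEmpty i).Yields S true := by
  intro K calls
  simp [Test.eval, h]

theorem yields_isEmpty_cons {i : ℕ} {S : Memory} {b : Bool} {w : List Bool}
    (h : S.stack i = b :: w) : (Test.isEmpty i).Yields S false := by
  intro K calls
  simp [Test.eval, h]

theorem yields_absLt {i j : ℕ} {S : Memory} {b : Bool}
    (h : b = true ↔ ‖S.regs i‖ < ‖S.regs j‖) : (Test.absLt i j).Yields S b := by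
  intro K calls
  simp only [Test.eval, ← h]
  simp

theorem yields_topIs_true {i : ℕ} {S : Memory} {w : List Bool}
    (h : S.stack i = true :: w) : (Test.topIs i true).Yields S true := yields_topIs h

theorem yields_topIs_false {i : ℕ} {S : Memory} {w : List Bool}
    (h : S.stack i = false :: w) : (Test.topIs i true).Yields S false := yields_topIs h

/-! ### Rewriting strings -/

/-- Moves the top of stack `0` to stack `1`. -/
def moveBit : Prog :=
  .ite (.topIs 0 true) (.seq (.push 1 true) (.pop 0)) (.seq (.push 1 false) (.pop 0))

theorem runs_moveBit (x : Bool) (a b c d e : List Bool) (r : ℕ → ℂ) :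
    Runs moveBit ⟨fiveStacks (x :: a) b c d e, r⟩ ⟨fiveStacks a (x :: b) c d e, r⟩ 4 := by
  have h : ∀ y, Runs (.seq (.push 1 y) (.pop 0)) ⟨fiveStacks (x :: a) b c d e, r⟩
      ⟨fiveStacks a (y :: b) c d e, r⟩ 3 := fun y => by
    simpa using (runs_push 1 y (fiveStacks (x :: a) b c d e) r).seq (runs_pop 0 _ r)
  have ht : (Test.topIs 0 true).Yields ⟨fiveStacks (x :: a) b c d e, r⟩ (x == true) :=
    yields_topIs rfl
  cases x
  · exact Runs.ite_false ht (h false)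
  · exact Runs.ite_true ht (h true)

/-- Pushes a word to stack `1`. -/
def pushWord : List Bool → Prog
  | [] => .pop 5
  | b :: w => .seq (.push 1 b) (pushWord w)

theorem runs_pushWord (w a b c d e : List Bool) (r : ℕ → ℂ) :
    Runs (pushWord w) ⟨fiveStacks a b c d e, r⟩ ⟨fiveStacks a (w.reverse ++ b) c d e, r⟩
      (2 * w.length + 1) := by
  induction w generalizing b with
  | nil => simpa [pushWord] using runs_pop 5 (fiveStacks a b c d e) r
  | cons x w ih =>
    have h := (runs_push 1 x (fiveStacks a b c d e) r).seq
      ((ih (x :: b)).cast (by simp) rfl rfl)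
    exact h.cast rfl (by simp) (by simp only [List.length_cons]; ring)

/-- With `N` tokens on stack `2` and no tokens on the stacks `3` and `4`, the program `p` removes
the word `w` from stack `0`, writes the word `w'` to stack `1`, and needs less than
`τ * w.length` steps. -/
def Rewrites (N τ : ℕ) (p : Prog) (w w' : List Bool) : Prop :=
  ∃ t, t + 1 ≤ τ * w.length ∧ ∀ (v b : List Bool) (r : ℕ → ℂ),
    Runs p ⟨fiveStacks (w ++ v) b (List.replicate N true) [] [], r⟩
      ⟨fiveStacks v (w'.reverse ++ b) (List.replicate N true) [] [], r⟩ t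

section Rewriting

variable {N τ : ℕ} {p q : Prog} {w w' z z' : List Bool}

theorem rewrites_moveBit (hτ : 10 ≤ τ) (x : Bool) : Rewrites N τ moveBit [x] [x] :=
  ⟨4, by simp; omega, fun v b r => by simpa using runs_moveBit x v b _ _ _ r⟩

/-- The spare step in each of the two bounds pays for unfolding `seq` and leaves one spare step
again. -/
theorem Rewrites.append (hp : Rewrites N τ p w w') (hq : Rewrites N τ q z z') :
    Rewrites N τ (.seq p q) (w ++ z) (w' ++ z') := by
  obtain ⟨t, ht, hp⟩ := hp
  obtain ⟨s, hs, hq⟩ := hq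
  refine ⟨1 + (t + s), by rw [List.length_append, mul_add]; omega, fun v b r => ?_⟩
  exact ((hp (z ++ v) b r).seq (hq v _ r)).cast (by simp) (by simp) rfl

/-- Moves one bit, and continues with `p` or `q` as this bit is `1` or `0`. -/
def moveBranch (p q : Prog) : Prog :=
  .ite (.topIs 0 true) (.seq moveBit p) (.seq moveBit q)

theorem Rewrites.moveBranch_true (hτ : 10 ≤ τ) (hp : Rewrites N τ p w w') :
    Rewrites N τ (moveBranch p q) (true :: w) (true :: w') := by
  obtain ⟨t, ht, hp⟩ := hp
  refine ⟨1 + (1 + (4 + t)), by rw [List.length_cons, mul_add]; omega, fun v b r => ?_⟩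
  exact (Runs.ite_true (yields_topIs_true rfl) ((runs_moveBit true _ _ _ _ _ r).seq
    (hp v (true :: b) r))).cast rfl (by simp) rfl

theorem Rewrites.moveBranch_false (hτ : 10 ≤ τ) (hq : Rewrites N τ q w w') :
    Rewrites N τ (moveBranch p q) (false :: w) (false :: w') := by
  obtain ⟨t, ht, hq⟩ := hq
  refine ⟨1 + (1 + (4 + t)), by rw [List.length_cons, mul_add]; omega, fun v b r => ?_⟩
  exact (Runs.ite_false (yields_topIs_false rfl) ((runs_moveBit false _ _ _ _ _ r).seq
    (hq v (false :: b) r))).cast rfl (by simp) rfl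

/-- Applies `p` to all items of a list, without removing the terminator. -/
def eachItem (p : Prog) : Prog := .loop (.topIs 0 true) (.seq moveBit p)

/-- Applies `p` to all items of a list. -/
def rewriteList (p : Prog) : Prog := .seq (eachItem p) moveBit

theorem encList_eq_flatMap {α : Type} (enc : α → List Bool) (l : List α) :
    encList enc l = l.flatMap (fun a => true :: enc a) ++ [false] := by
  induction l with
  | nil => rfl
  | cons a l ih => simp [encList, ih]

/-- Each announcing bit pays for the loop overhead of its item. The terminator also counts τ in the
budget, but leaving the loop costs a single step; the remaining τ - 1 steps are kept for what is
done at the terminator. -/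
theorem runs_eachItem (hτ : 10 ≤ τ) {α : Type} {enc enc' : α → List Bool} {l : List α}
    (h : ∀ a ∈ l, Rewrites N τ p (enc a) (enc' a)) :
    ∃ t, t + τ ≤ τ * (encList enc l).length + 1 ∧ ∀ (v b : List Bool) (r : ℕ → ℂ),
      Runs (eachItem p) ⟨fiveStacks (encList enc l ++ v) b (List.replicate N true) [] [], r⟩
        ⟨fiveStacks (false :: v) ((l.flatMap (fun a => true :: enc' a)).reverse ++ b)
          (List.replicate N true) [] [], r⟩ t := by
  induction l with
  | nil => exact ⟨1, by simp [encList]; omega, fun v b r => runs_loop_false (yields_topIs_false rfl)⟩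
  | cons a l ih =>
    obtain ⟨t, ht, hp⟩ := h a (by simp)
    obtain ⟨s, hs, hl⟩ := ih fun a' ha => h a' (by simp [ha])
    refine ⟨1 + (1 + (4 + t) + s), ?_, fun v b r => ?_⟩
    · simp only [encList, List.length_cons, List.length_append, mul_add]
      omega
    · refine Runs.loop_true (yields_topIs_true rfl)
        ((runs_moveBit true _ _ _ _ _ r).seq ((hp _ (true :: b) r).cast (by simp) rfl rfl))
        ((hl v ((enc' a).reverse ++ true :: b) r).cast rfl (by simp) rfl)

theorem rewrites_rewriteList (hτ : 10 ≤ τ) {α : Type} {enc enc' : α → List Bool} {l : List α}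
    (h : ∀ a ∈ l, Rewrites N τ p (enc a) (enc' a)) :
    Rewrites N τ (rewriteList p) (encList enc l) (encList enc' l) := by
  obtain ⟨t, ht, hl⟩ := runs_eachItem hτ h
  refine ⟨1 + (t + 4), by omega, fun v b r => ?_⟩
  exact ((hl v b r).seq (runs_moveBit false _ _ _ _ _ r)).cast rfl
    (by simp [encList_eq_flatMap enc']) rfl

def copyUnary : Prog := .seq (.loop (.topIs 0 true) moveBit) moveBit

theorem rewrites_copyUnary (hτ : 10 ≤ τ) (n : ℕ) :
    Rewrites N τ copyUnary (encUnary n) (encUnary n) := by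
  have h : ∀ n, ∃ t, t = 5 * n + 1 ∧ ∀ (v b : List Bool) (r : ℕ → ℂ),
      Runs (.loop (.topIs 0 true) moveBit)
        ⟨fiveStacks (encUnary n ++ v) b (List.replicate N true) [] [], r⟩
        ⟨fiveStacks (false :: v) (List.replicate n true ++ b)
          (List.replicate N true) [] [], r⟩ t := by
    intro n
    induction n with
    | zero => exact ⟨1, rfl, fun v b r => runs_loop_false (yields_topIs_false rfl)⟩
    | succ n ih =>
      obtain ⟨s, hs, hl⟩ := ih
      refine ⟨1 + (4 + s), by omega, fun v b r => ?_⟩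
      refine Runs.loop_true (yields_topIs_true rfl) (runs_moveBit true _ _ _ _ _ r)
        ((hl v _ r).cast rfl ?_ rfl)
      rw [List.replicate_succ', List.append_assoc, List.singleton_append]
  obtain ⟨t, ht, hl⟩ := h n
  refine ⟨1 + (t + 4), ?_, fun v b r => ?_⟩
  · have := Nat.mul_le_mul_right (n + 1) hτ
    simp [encUnary]
    omega
  · exact ((hl v b r).seq (runs_moveBit false _ _ _ _ _ r)).cast rfl (by simp [encUnary]) rfl

/-! ### Copying the codes of frames -/

def copyNat : Prog := rewriteList moveBit

theorem rewrites_copyNat (hτ : 10 ≤ τ) (n : ℕ) : Rewrites N τ copyNat (encNat n) (encNat n) :=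
  rewrites_rewriteList hτ fun b _ => rewrites_moveBit hτ b

def copyInt : Prog := .seq moveBit copyNat

theorem rewrites_copyInt (hτ : 10 ≤ τ) (n : ℤ) : Rewrites N τ copyInt (encInt n) (encInt n) :=
  (rewrites_moveBit hτ _).append (rewrites_copyNat hτ _)

def copyLine : Prog :=
  moveBranch (.seq (.seq moveBit moveBit) (.seq copyUnary copyUnary))
    (.seq (rewriteList copyInt) (.seq copyInt (.seq copyInt copyNat)))

theorem rewrites_copyLine (hτ : 10 ≤ τ) (l : Line) :
    Rewrites N τ copyLine (encLine l) (encLine l) := by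
  cases l with
  | root p a b d =>
    exact Rewrites.moveBranch_false hτ
      ((rewrites_rewriteList hτ fun c _ => rewrites_copyInt hτ c).append
        ((rewrites_copyInt hτ a).append ((rewrites_copyInt hτ b).append (rewrites_copyNat hτ d))))
  | op o i j =>
    have ho : Rewrites N τ (.seq moveBit moveBit) (encArithOp o) (encArithOp o) := by
      cases o <;> exact (rewrites_moveBit hτ _).append (rewrites_moveBit hτ _)
    exact Rewrites.moveBranch_true hτ
      (ho.append ((rewrites_copyUnary hτ i).append (rewrites_copyUnary hτ j)))

def copyNum : Prog := rewriteList copyLine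

theorem rewrites_copyNum (hτ : 10 ≤ τ) (s : NumCode) :
    Rewrites N τ copyNum (encNum s) (encNum s) :=
  rewrites_rewriteList hτ fun l _ => rewrites_copyLine hτ l

end Rewriting

/-! ### Perturbing the values of the unary constraints -/

/-- Adds `(1/4) ^ 2 ^ N` to the specified number. -/
def NumCode.perturb (N : ℕ) (s : NumCode) : NumCode :=
  s ++ Line.root [-1, 4] 0 0 1 :: (List.replicate N (Line.op .mul 0 0) ++ [Line.op .add 0 (N + 1)])

/-- Every unary node is perturbed, even one whose label lies in `F`: the machine can see the arity,
but not membership in the arbitrary set `F`. -/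
def NodeCode.perturb (N : ℕ) {n : ℕ} (v : NodeCode n) : NodeCode n where
  arity := v.arity
  scope := v.scope
  table y := if v.arity = 1 then NumCode.perturb N (v.table y) else v.table y

def FrameCode.perturb (N : ℕ) (c : FrameCode) : FrameCode where
  n := c.n
  nodes := c.nodes.map (NodeCode.perturb N)

/-- Writes the lines that `NumCode.perturb` adds. -/
def writePerturbation : Prog :=
  .seq (pushWord (true :: encLine (.root [-1, 4] 0 0 1)))
    (.seq (.loop (.topIs 2 true) (.seq (.pop 2) (.seq (.push 3 true)
        (pushWord (true :: encLine (.op .mul 0 0))))))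
      -- Announcing bit, tag of an operation, code of `add`, and unary `0`. The tokens then supply
      -- `N` ones, and the final `true, false` completes the unary code of `N + 1`.
      (.seq (pushWord [true, true, false, false, false])
        (.seq (.loop (.topIs 3 true) (.seq (.pop 3) (.seq (.push 2 true) (.push 1 true))))
          (pushWord [true, false]))))

theorem runs_writeSquarings (n : ℕ) (a b c d : List Bool) (r : ℕ → ℂ) (hc : c.head? ≠ some true) :
    Runs (.loop (.topIs 2 true) (.seq (.pop 2) (.seq (.push 3 true)
        (pushWord (true :: encLine (.op .mul 0 0))))))
      ⟨fiveStacks a b (List.replicate n true ++ c) d [], r⟩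
      ⟨fiveStacks a (((List.replicate n (Line.op .mul 0 0)).flatMap
        (fun l => true :: encLine l)).reverse ++ b) c (List.replicate n true ++ d) [], r⟩
      (18 * n + 1) := by
  induction n generalizing b d with
  | zero =>
    refine (runs_loop_false ?_).cast rfl (by simp) rfl
    rcases c with _ | ⟨x, c⟩
    · exact yields_topIs_nil rfl
    · cases x
      · exact yields_topIs_false rfl
      · simp at hc
  | succ n ih =>
    have h1 := (runs_pop 2 (fiveStacks a b (List.replicate (n + 1) true ++ c) d []) r).seq
      ((runs_push 3 true _ r).seq ((runs_pushWord (true :: encLine (.op .mul 0 0)) a b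
        (List.replicate n true ++ c) (true :: d) [] r).cast (by simp [List.replicate_succ]) rfl rfl))
    refine (Runs.loop_true (yields_topIs_true rfl) h1 (ih _ _)).cast rfl ?_ ?_
    · have : List.replicate (n + 1) true ++ d = List.replicate n true ++ true :: d := by
        rw [List.replicate_succ', List.append_assoc]; rfl
      rw [this]
      simp [List.replicate_succ]
    · simp [encLine, encArithOp, encUnary]
      ring

theorem runs_writeTokens (n : ℕ) (a b c : List Bool) (r : ℕ → ℂ) :
    Runs (.loop (.topIs 3 true) (.seq (.pop 3) (.seq (.push 2 true) (.push 1 true))))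
      ⟨fiveStacks a b c (List.replicate n true) [], r⟩
      ⟨fiveStacks a (List.replicate n true ++ b) (List.replicate n true ++ c) [] [], r⟩
      (6 * n + 1) := by
  induction n generalizing b c with
  | zero => exact (runs_loop_false (yields_topIs_nil rfl)).cast rfl (by simp) rfl
  | succ n ih =>
    have h1 := (runs_pop 3 (fiveStacks a b c (List.replicate (n + 1) true) []) r).seq
      ((runs_push 2 true _ r).seq (runs_push 1 true _ r))
    refine (Runs.loop_true (yields_topIs_true rfl) h1
      ((ih (true :: b) (true :: c)).cast (by simp [List.replicate_succ]) rfl rfl)).cast rfl ?_ ?_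
    · simp only [List.replicate_succ', List.append_assoc, List.singleton_append]
    · ring

theorem runs_writePerturbation (N : ℕ) (a b : List Bool) (r : ℕ → ℂ) :
    Runs writePerturbation ⟨fiveStacks a b (List.replicate N true) [] [], r⟩
      ⟨fiveStacks a (((Line.root [-1, 4] 0 0 1 :: (List.replicate N (Line.op .mul 0 0) ++
        [Line.op .add 0 (N + 1)])).flatMap (fun l => true :: encLine l)).reverse ++ b)
        (List.replicate N true) [] [], r⟩
      (2 * (encLine (.root [-1, 4] 0 0 1)).length + 24 * N + 25) := by
  have h := (runs_pushWord (true :: encLine (.root [-1, 4] 0 0 1)) a b (List.replicate N true)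
    [] [] r).seq (((runs_writeSquarings N a
      ((encLine (.root [-1, 4] 0 0 1)).reverse ++ true :: b) [] [] r (by simp)).cast (by simp) rfl rfl).seq
      ((runs_pushWord [true, true, false, false, false] a _ [] _ [] r).seq
        (((runs_writeTokens N a _ [] r).cast (by simp; rfl) rfl rfl).seq
          (runs_pushWord [true, false] a _ _ [] [] r))))
  have hadd : encLine (.op .add 0 (N + 1)) =
      true :: false :: false :: false :: (List.replicate N true ++ [true, false]) := by
    simp [encLine, encArithOp, encUnary, List.replicate_succ']
  refine h.cast rfl ?_ ?_
  · simp [hadd]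
  · simp only [List.length_cons, List.length_nil]
    ring

theorem Rewrites.congr {N τ : ℕ} {p : Prog} {u u' w w' : List Bool} (h : Rewrites N τ p u u')
    (hw : u = w) (hw' : u' = w') : Rewrites N τ p w w' := by
  subst hw hw'; exact h

/-- Since `eachItem` stops in front of the terminator, lines can be appended before the terminator
is copied. -/
def perturbNum : Prog := .seq (eachItem copyLine) (.seq writePerturbation moveBit)

/-- The number of steps per input bit that suffices for perturbing a frame. -/
def perturbCost (N : ℕ) : ℕ := 24 * N + (2 * (encLine (.root [-1, 4] 0 0 1)).length + 40)

/-- The appended lines are paid for by the budget of the terminator that `runs_eachItem` leaves;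
`perturbCost` is chosen large enough for this. -/
theorem rewrites_perturbNum {N : ℕ} (s : NumCode) :
    Rewrites N (perturbCost N) perturbNum (encNum s) (encNum (s.perturb N)) := by
  have hτ : 10 ≤ perturbCost N := by unfold perturbCost; omega
  obtain ⟨t, ht, hl⟩ := runs_eachItem hτ (fun l (_ : l ∈ s) => rewrites_copyLine (N := N) hτ l)
  have hle : 1 ≤ (encList encLine s).length := by cases s <;> simp [encList]
  refine ⟨_, ?_, fun v b r => ((hl v b r).seq ((runs_writePerturbation N _ _ r).seq
    (runs_moveBit false _ _ _ _ _ r))).cast rfl ?_ rfl⟩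
  · have h := Nat.mul_le_mul_left (perturbCost N) hle
    unfold encNum
    generalize hP : perturbCost N * (encList encLine s).length = P at *
    unfold perturbCost at ht h
    omega
  · simp [encNum, encList_eq_flatMap, NumCode.perturb]

/-- The announcing bits in the code of the scope reveal the arity: an initial `0` means arity zero,
a `0` after the first variable means arity one, and only then is the table perturbed. -/
def perturbNode : Prog :=
  moveBranch
    (.seq copyUnary (moveBranch
      (.seq copyUnary (.seq (rewriteList copyUnary) (rewriteList copyNum)))
      (rewriteList perturbNum)))
    (rewriteList copyNum)

theorem encList_map {α β : Type} (enc : β → List Bool) (f : α → β) (l : List α) :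
    encList enc (l.map f) = encList (fun a => enc (f a)) l := by
  induction l with
  | nil => rfl
  | cons a l ih => simp [encList, ih]

theorem rewrites_perturbNode {N n : ℕ} (v : NodeCode n) :
    Rewrites N (perturbCost N) perturbNode (encNode v) (encNode (v.perturb N)) := by
  have hτ : 10 ≤ perturbCost N := by unfold perturbCost; omega
  have hu : ∀ k, Rewrites N (perturbCost N) copyUnary (encUnary k) (encUnary k) :=
    fun k => rewrites_copyUnary hτ k
  have hcopy : ∀ l : List NumCode,
      Rewrites N (perturbCost N) (rewriteList copyNum) (encList encNum l) (encList encNum l) :=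
    fun l => rewrites_rewriteList hτ fun s _ => rewrites_copyNum hτ s
  obtain ⟨k, sc, t⟩ := v
  unfold encNode NodeCode.perturb
  rcases k with _ | _ | k
  · exact (Rewrites.moveBranch_false hτ (hcopy ((boolVectors 0).map t))).congr
      (by simp [encList]) (by simp [encList])
  · have h : Rewrites N (perturbCost N) (rewriteList perturbNum)
        (encList encNum ((boolVectors 1).map t))
        (encList encNum ((boolVectors 1).map fun y => (t y).perturb N)) := by
      rw [encList_map, encList_map]
      exact rewrites_rewriteList hτ fun y _ => rewrites_perturbNum (t y)
    refine (Rewrites.moveBranch_true hτ ((hu (sc 0)).append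
      (Rewrites.moveBranch_false hτ h))).congr ?_ ?_ <;> simp [encList]
  · have hs : ∀ l : List (Fin n), Rewrites N (perturbCost N) (rewriteList copyUnary)
        (encList (fun i : Fin n => encUnary i) l) (encList (fun i : Fin n => encUnary i) l) :=
      fun l => rewrites_rewriteList hτ fun i _ => hu i
    refine (Rewrites.moveBranch_true hτ ((hu (sc 0)).append
      (Rewrites.moveBranch_true hτ ((hu (sc 1)).append ((hs (List.ofFn fun i => sc i.succ.succ)).append
        (hcopy ((boolVectors (k + 2)).map t))))))).congr ?_ ?_ <;>
      simp [encList, List.ofFn_succ]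

def perturbFrame : Prog := .seq copyUnary (rewriteList perturbNode)

theorem rewrites_perturbFrame {N : ℕ} (c : FrameCode) :
    Rewrites N (perturbCost N) perturbFrame (encFrame c) (encFrame (c.perturb N)) := by
  have hτ : 10 ≤ perturbCost N := by unfold perturbCost; omega
  unfold encFrame FrameCode.perturb
  refine (rewrites_copyUnary hτ c.n).append ?_
  rw [encList_map]
  exact rewrites_rewriteList hτ fun v _ => rewrites_perturbNode v

/-! ### The stacks grow slowly -/

theorem Config.length_stack_step {M : RandomizedMap} {c c' : Config} (i : ℕ)
    (h : c' ∈ (c.step M).support) : (c'.stack i).length ≤ (c.stack i).length + 1 := by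
  obtain ⟨todo, s, r, calls⟩ := c
  unfold Config.step at h
  split at h <;> simp only [PMF.support_pure, PMF.support_map, Set.mem_singleton_iff,
    Set.mem_image] at h
  · subst h; simp
  · subst h; rename_i j b _ _; by_cases hj : i = j <;> simp [Function.update, hj]
  · subst h; rename_i j _ _
    by_cases hj : i = j
    · subst hj; simp; omega
    · simp [Function.update, hj]
  · subst h; simp
  · subst h; simp
  · obtain ⟨z, -, rfl⟩ := h; simp
  · subst h; simp
  · obtain ⟨z, -, rfl⟩ := h; simp
  · obtain ⟨z, -, rfl⟩ := h; simp

theorem Config.length_stack_run {M : RandomizedMap} {n : ℕ} {c c' : Config} (i : ℕ)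
    (h : c' ∈ (Config.run M n c).support) : (c'.stack i).length ≤ (c.stack i).length + n := by
  induction n generalizing c with
  | zero =>
    simp only [Config.run, PMF.support_pure, Set.mem_singleton_iff] at h
    simp [h]
  | succ n ih =>
    simp only [Config.run, PMF.mem_support_bind_iff] at h
    obtain ⟨d, hd, h⟩ := h
    have h1 := Config.length_stack_step i hd
    have h2 := ih h
    omega

theorem Runs.length_stack {p : Prog} {S S' : Memory} {t : ℕ} (h : Runs p S S' t) (i : ℕ) :
    (S'.stack i).length ≤ (S.stack i).length + t := by
  have h1 := h (fun _ _ => PMF.pure 0) [] [] 0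
  have h2 : (⟨[], S'.stack, S'.regs, []⟩ : Config) ∈
      (Config.run (fun _ _ => PMF.pure 0) (t + 0) ⟨[p], S.stack, S.regs, []⟩).support := by
    rw [h1]
    simp [Config.run]
  exact Config.length_stack_run i h2

/-- One step lengthens a stack by at most one bit, so the running time bounds the output. This
controls the cost of moving the rewritten code back to stack 0. -/
theorem Rewrites.length_le {N τ : ℕ} {p : Prog} {w w' : List Bool} (h : Rewrites N τ p w w') :
    w'.length ≤ τ * w.length := by
  obtain ⟨t, ht, h⟩ := h
  have := (h [] [] (fun _ => 0)).length_stack 1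
  simp at this
  omega

/-! ### Choosing the size of the perturbation -/

/-- Squares register `4` and puts a token on stack `2`. -/
def square : Prog := .seq (.arith .mul 4 4 4) (.push 2 true)

theorem runs_square (j : ℕ) (a b d e : List Bool) (x y z w : ℂ) :
    Runs square
      ⟨fiveStacks a b (List.replicate j true) d e, fiveRegs x y z w ((1 / 2) ^ 2 ^ j)⟩
      ⟨fiveStacks a b (List.replicate (j + 1) true) d e,
        fiveRegs x y z w ((1 / 2) ^ 2 ^ (j + 1))⟩ 3 := by
  refine ((runs_arith .mul 4 4 4 _ _).seq (runs_push 2 true _ _)).cast rfl ?_ rfl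
  have : ((1 / 2 : ℂ) ^ 2 ^ j) * ((1 / 2 : ℂ) ^ 2 ^ j) = (1 / 2 : ℂ) ^ 2 ^ (j + 1) := by
    rw [pow_succ 2 j, pow_mul, sq]
  simp only [ArithOp.apply, fiveRegs_four, this, update_fiveRegs_four, fiveStacks_two,
    update_fiveStacks_two, List.replicate_succ]

def squareTimes : ℕ → Prog
  | 0 => .pop 5
  | m + 1 => .seq square (squareTimes m)

theorem runs_squareTimes (m j : ℕ) (a b d e : List Bool) (x y z w : ℂ) :
    Runs (squareTimes m)
      ⟨fiveStacks a b (List.replicate j true) d e, fiveRegs x y z w ((1 / 2) ^ 2 ^ j)⟩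
      ⟨fiveStacks a b (List.replicate (j + m) true) d e,
        fiveRegs x y z w ((1 / 2) ^ 2 ^ (j + m))⟩ (4 * m + 1) := by
  induction m generalizing j with
  | zero => exact (runs_pop 5 _ _).cast rfl (by simp) rfl
  | succ m ih =>
    refine ((runs_square j a b d e x y z w).seq (ih (j + 1))).cast rfl ?_ (by ring)
    rw [show j + 1 + m = j + (m + 1) by ring]

/-- Squares register `4` until it does not exceed register `3`. -/
def squareUntil : Prog := .loop (.absLt 3 4) square

theorem norm_half_pow (n : ℕ) : ‖(1 / 2 : ℂ) ^ n‖ = (1 / 2 : ℝ) ^ n := by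
  rw [norm_pow]; norm_num

/-- The least such `k` is the number of rounds of `squareUntil`. By minimality 2^(2^(k-1)) < 1/δ if
k > 0, so `k` is really doubly logarithmic; the linear bound is enough for polynomial time. -/
theorem exists_half_pow_le {δ : ℝ} (hδ : 0 < δ) :
    ∃ k : ℕ, (1 / 2 : ℝ) ^ 2 ^ k ≤ δ ∧ (∀ j < k, δ < (1 / 2 : ℝ) ^ 2 ^ j) ∧ (k : ℝ) ≤ 1 / δ + 1 := by
  classical
  have hex : ∃ k : ℕ, (1 / 2 : ℝ) ^ 2 ^ k ≤ δ := by
    obtain ⟨n, hn⟩ := exists_pow_lt_of_lt_one hδ (by norm_num : (1 / 2 : ℝ) < 1)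
    exact ⟨n, (pow_le_pow_of_le_one (by norm_num) (by norm_num) Nat.lt_two_pow_self.le).trans hn.le⟩
  refine ⟨Nat.find hex, Nat.find_spec hex, fun j hj => not_le.1 (Nat.find_min hex hj), ?_⟩
  rcases Nat.eq_zero_or_pos (Nat.find hex) with h0 | h0
  · rw [h0]; push_cast; positivity
  · obtain ⟨k, hk⟩ := Nat.exists_eq_succ_of_ne_zero h0.ne'
    have h := not_le.1 (Nat.find_min hex (m := k) (by omega))
    rw [hk, Nat.succ_eq_add_one]
    push_cast
    have h1 : (k : ℝ) ≤ 2 ^ 2 ^ k := by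
      have : k ≤ 2 ^ 2 ^ k := Nat.lt_two_pow_self.le.trans Nat.lt_two_pow_self.le
      exact_mod_cast this
    have h2 : (2 : ℝ) ^ 2 ^ k ≤ 1 / δ := by
      rw [le_div_iff₀ hδ]
      rw [one_div, inv_pow] at h
      have := mul_lt_mul_of_pos_left h (show (0 : ℝ) < 2 ^ 2 ^ k by positivity)
      rw [mul_inv_cancel₀ (by positivity)] at this
      exact this.le
    linarith

theorem runs_squareUntil {δ : ℝ} (hδ : 0 < δ) {k : ℕ} (hk : (1 / 2 : ℝ) ^ 2 ^ k ≤ δ)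
    (hlt : ∀ j < k, δ < (1 / 2 : ℝ) ^ 2 ^ j) (a b d e : List Bool) (x y z : ℂ) :
    Runs squareUntil ⟨fiveStacks a b [] d e, fiveRegs x y z δ (1 / 2)⟩
      ⟨fiveStacks a b (List.replicate k true) d e, fiveRegs x y z δ ((1 / 2) ^ 2 ^ k)⟩
      (4 * k + 1) := by
  have hn : ‖(δ : ℂ)‖ = δ := by rw [Complex.norm_real, Real.norm_of_nonneg hδ.le]
  have h : ∀ m j, j + m = k → Runs squareUntil
      ⟨fiveStacks a b (List.replicate j true) d e, fiveRegs x y z δ ((1 / 2) ^ 2 ^ j)⟩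
      ⟨fiveStacks a b (List.replicate k true) d e, fiveRegs x y z δ ((1 / 2) ^ 2 ^ k)⟩
      (4 * m + 1) := by
    intro m
    induction m with
    | zero =>
      rintro j rfl
      refine runs_loop_false (yields_absLt ?_)
      simp only [fiveRegs_three, fiveRegs_four, hn, norm_half_pow]
      simpa using hk
    | succ m ih =>
      intro j hj
      refine (Runs.loop_true (yields_absLt ?_) (runs_square j a b d e x y z δ)
        (ih (j + 1) (by omega))).cast rfl rfl (by ring)
      simp only [fiveRegs_three, fiveRegs_four, hn, norm_half_pow]
      simpa using hlt j (by omega)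
  simpa using h k 0 (by omega)

/-- Moves stack `0` to stack `1`, squaring register `4` eight times for every bit. -/
def squarePerBit : Prog :=
  .seq (.push 4 true) (.loop (.topIs 4 true)
    (.ite (.isEmpty 0) (.pop 4) (.seq moveBit (squareTimes 8))))

theorem runs_squarePerBit (u : List Bool) (j : ℕ) (b d : List Bool) (x y z w : ℂ) :
    Runs squarePerBit
      ⟨fiveStacks u b (List.replicate j true) d [], fiveRegs x y z w ((1 / 2) ^ 2 ^ j)⟩
      ⟨fiveStacks [] (u.reverse ++ b) (List.replicate (j + 8 * u.length) true) d [],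
        fiveRegs x y z w ((1 / 2) ^ 2 ^ (j + 8 * u.length))⟩ (40 * u.length + 6) := by
  have h : Runs (.loop (.topIs 4 true)
        (.ite (.isEmpty 0) (.pop 4) (.seq moveBit (squareTimes 8))))
      ⟨fiveStacks u b (List.replicate j true) d [true], fiveRegs x y z w ((1 / 2) ^ 2 ^ j)⟩
      ⟨fiveStacks [] (u.reverse ++ b) (List.replicate (j + 8 * u.length) true) d [],
        fiveRegs x y z w ((1 / 2) ^ 2 ^ (j + 8 * u.length))⟩ (40 * u.length + 4) := by
    induction u generalizing b j with
    | nil =>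
      refine Runs.loop_true (yields_topIs_true rfl)
        (Runs.ite_true (yields_isEmpty_nil rfl) (runs_pop 4 _ _))
        ((runs_loop_false (S := ⟨fiveStacks [] b (List.replicate j true) d [],
            fiveRegs x y z w ((1 / 2) ^ 2 ^ j)⟩)
          (yields_topIs_nil rfl)).cast ?_ ?_ rfl) <;> simp
    | cons c u ih =>
      refine (Runs.loop_true (yields_topIs_true rfl)
        (Runs.ite_false (yields_isEmpty_cons rfl) ((runs_moveBit c u _ _ _ _ _).seq
          (runs_squareTimes 8 j u _ _ _ x y z w)))
        (ih (j + 8) _)).cast rfl ?_ ?_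
      · rw [show j + 8 + 8 * u.length = j + 8 * (c :: u).length by simp; ring]
        simp
      · simp only [List.length_cons]; ring
  exact ((runs_push 4 true (fiveStacks u b (List.replicate j true) d []) _).seq
    (h.cast (by simp) rfl rfl)).cast rfl rfl (by ring)

/-- Moves stack `1` to stack `0`. -/
def moveBack : Prog :=
  .seq (.push 4 true) (.loop (.topIs 4 true) (.ite (.isEmpty 1) (.pop 4)
    (.ite (.topIs 1 true) (.seq (.push 0 true) (.pop 1)) (.seq (.push 0 false) (.pop 1)))))

theorem runs_moveBack (u a c d : List Bool) (r : ℕ → ℂ) :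
    Runs moveBack ⟨fiveStacks a u c d [], r⟩ ⟨fiveStacks (u.reverse ++ a) [] c d [], r⟩
      (6 * u.length + 6) := by
  have h : Runs (.loop (.topIs 4 true) (.ite (.isEmpty 1) (.pop 4)
      (.ite (.topIs 1 true) (.seq (.push 0 true) (.pop 1)) (.seq (.push 0 false) (.pop 1)))))
      ⟨fiveStacks a u c d [true], r⟩ ⟨fiveStacks (u.reverse ++ a) [] c d [], r⟩
      (6 * u.length + 4) := by
    induction u generalizing a with
    | nil =>
      refine Runs.loop_true (yields_topIs_true rfl)
        (Runs.ite_true (yields_isEmpty_nil rfl) (runs_pop 4 _ _))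
        ((runs_loop_false (S := ⟨fiveStacks a [] c d [], r⟩)
          (yields_topIs_nil rfl)).cast ?_ ?_ rfl) <;> simp
    | cons x u ih =>
      have h : ∀ y, Runs (.seq (.push 0 y) (.pop 1)) ⟨fiveStacks a (x :: u) c d [true], r⟩
          ⟨fiveStacks (y :: a) u c d [true], r⟩ 3 := fun y => by
        simpa using (runs_push 0 y (fiveStacks a (x :: u) c d [true]) r).seq (runs_pop 1 _ r)
      have hx : Runs (.ite (.topIs 1 true) (.seq (.push 0 true) (.pop 1))
          (.seq (.push 0 false) (.pop 1))) ⟨fiveStacks a (x :: u) c d [true], r⟩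
          ⟨fiveStacks (x :: a) u c d [true], r⟩ 4 := by
        cases x
        · exact Runs.ite_false (yields_topIs_false rfl) (h false)
        · exact Runs.ite_true (yields_topIs_true rfl) (h true)
      refine (Runs.loop_true (yields_topIs_true rfl)
        (Runs.ite_false (yields_isEmpty_cons rfl) hx) (ih _)).cast rfl ?_ ?_
      · simp
      · simp only [List.length_cons]; ring
  exact ((runs_push 4 true (fiveStacks a u c d []) _).seq
    (h.cast (by simp) rfl rfl)).cast rfl rfl (by ring)

/-! ### The reduction -/

def loadConstants : Prog :=
  .seq (.setOne 1) (.seq (.arith .add 1 1 2) (.seq (.arith .div 0 2 3) (.arith .div 1 2 4)))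

theorem runs_loadConstants (s : ℕ → List Bool) (ε : ℝ) :
    Runs loadConstants ⟨s, fiveRegs ε 0 0 0 0⟩ ⟨s, fiveRegs ε 1 2 ((ε / 2 : ℝ) : ℂ) (1 / 2)⟩ 7 := by
  refine ((runs_setOne 1 _ _).seq ((runs_arith .add 1 1 2 _ _).seq
    ((runs_arith .div 0 2 3 _ _).seq (runs_arith .div 1 2 4 _ _)))).cast rfl ?_ rfl
  simp [ArithOp.apply]
  norm_num

/-- The tokens and register 4 are advanced together: `k` squarings to get below ε/2, then 8 more,
then 8 for every input bit. The first `moveBack` restores the input that `squarePerBit` reversed,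
the second one the output that `perturbFrame` wrote in reverse. -/
def prepare : Prog :=
  .seq loadConstants (.seq squareUntil (.seq (squareTimes 8) (.seq squarePerBit
    (.seq moveBack (.seq perturbFrame moveBack)))))

/-- Sets register `0` to `0` if it is smaller than register `4`. -/
def cutoff : Prog := .ite (.absLt 0 4) (.arith .sub 0 0 0) (.pop 5)

/-- Asks the oracle for an approximate value of the perturbed frame. -/
def perturbAndQuery : Prog := .seq prepare (.seq (.query 0 3 0) cutoff)

theorem exists_runs_prepare {ε : ℝ} (hε : 0 < ε) {k : ℕ} (hk : (1 / 2 : ℝ) ^ 2 ^ k ≤ ε / 2)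
    (hlt : ∀ j < k, ε / 2 < (1 / 2 : ℝ) ^ 2 ^ j) (c : FrameCode) {N : ℕ}
    (hN : N = k + 8 + 8 * (encFrame c).length) :
    ∃ t ≤ 7 * (perturbCost N * (encFrame c).length) + 4 * k + 46 * (encFrame c).length + 100,
      Runs prepare ⟨fiveStacks (encFrame c) [] [] [] [], fiveRegs ε 0 0 0 0⟩
        ⟨fiveStacks (encFrame (c.perturb N)) [] (List.replicate N true) [] [],
          fiveRegs ε 1 2 ((ε / 2 : ℝ) : ℂ) ((1 / 2) ^ 2 ^ N)⟩ t := by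
  -- Rewriting costs at most `perturbCost N` per input bit, and moving back costs six steps for each
  -- of at most as many output bits; hence the factor 7.
  have hlen := (rewrites_perturbFrame (N := N) c).length_le
  obtain ⟨t, ht, h⟩ := rewrites_perturbFrame (N := N) c
  have hrun := (runs_loadConstants (fiveStacks (encFrame c) [] [] [] []) ε).seq
    ((runs_squareUntil (by positivity) hk hlt _ _ _ _ _ _ _).seq
      ((runs_squareTimes 8 k _ _ _ _ _ _ _ _).seq
        ((runs_squarePerBit (encFrame c) (k + 8) _ _ _ _ _ _).seq
          ((runs_moveBack ((encFrame c).reverse ++ []) _ _ _ _).seq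
            (((h [] [] (fiveRegs ε 1 2 ((ε / 2 : ℝ) : ℂ) ((1 / 2) ^ 2 ^ N))).cast
              (by simp [hN]) rfl rfl).seq
              (runs_moveBack _ _ _ _ _))))))
  refine ⟨_, ?_, hrun.cast rfl (by simp) rfl⟩
  simp only [List.append_nil, List.length_reverse]
  omega

theorem run_perturbAndQuery {ε : ℝ} {S : Memory} {N t : ℕ} {w : List Bool}
    (h : Runs prepare S ⟨fiveStacks w [] (List.replicate N true) [] [],
      fiveRegs ε 1 2 ((ε / 2 : ℝ) : ℂ) ((1 / 2) ^ 2 ^ N)⟩ t) (M : RandomizedMap) (n : ℕ)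
    (hn : t + 5 ≤ n) :
    Config.run M n ⟨[perturbAndQuery], S.stack, S.regs, []⟩ =
      (M w (ε / 2)).bind fun z => PMF.pure
        ⟨[], fiveStacks w [] (List.replicate N true) [] [],
          fiveRegs (if ‖z‖ < (1 / 2 : ℝ) ^ 2 ^ N then 0 else z) 1 2 ((ε / 2 : ℝ) : ℂ)
            ((1 / 2) ^ 2 ^ N), [(w, ((ε / 2 : ℝ) : ℂ))]⟩ := by
  obtain ⟨m, rfl⟩ := Nat.exists_eq_add_of_le hn
  -- One step for each `seq`, one for the query, two for `cutoff`; the last `m` steps are idle.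
  rw [show t + 5 + m = 1 + (t + (1 + (1 + (2 + m)))) by ring, perturbAndQuery,
    Config.run_succ_of_step rfl, h, Config.run_succ_of_step rfl, run_query]
  simp only [fiveStacks_zero, fiveRegs_three, Complex.ofReal_re, update_fiveRegs_zero]
  congr 1
  funext z
  have hc : Runs cutoff ⟨fiveStacks w [] (List.replicate N true) [] [],
      fiveRegs z 1 2 ((ε / 2 : ℝ) : ℂ) ((1 / 2) ^ 2 ^ N)⟩
      ⟨fiveStacks w [] (List.replicate N true) [] [],
          fiveRegs (if ‖z‖ < (1 / 2 : ℝ) ^ 2 ^ N then 0 else z) 1 2 ((ε / 2 : ℝ) : ℂ)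
            ((1 / 2) ^ 2 ^ N)⟩ 2 := by
    by_cases hz : ‖z‖ < (1 / 2 : ℝ) ^ 2 ^ N
    · refine (Runs.ite_true (yields_absLt ?_) (runs_arith .sub 0 0 0 _ _)).cast rfl ?_ rfl
      · simp only [fiveRegs_zero, fiveRegs_four, norm_half_pow, hz]
      · rw [if_pos hz]; simp [ArithOp.apply]
    · refine (Runs.ite_false (yields_absLt ?_) (runs_pop 5 _ _)).cast rfl ?_ rfl
      · simp [-one_div, -inv_pow, hz]
      · rw [if_neg hz]; simp
  rw [hc M [] _ m, Config.run_halted]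
  rfl

/-! ### Size of algebraic numbers -/

section Size

open Module

variable (K : IntermediateField ℚ ℂ)

/-- `z` is a fraction of algebraic integers of `K` all of whose conjugates are at most `2 ^ b` in
absolute value. -/
def FracBounded (b : ℕ) (z : ℂ) : Prop :=
  ∃ u v : K, IsIntegral ℤ u ∧ IsIntegral ℤ v ∧ v ≠ 0 ∧
    (∀ σ : K →+* ℂ, ‖σ u‖ ≤ 2 ^ b ∧ ‖σ v‖ ≤ 2 ^ b) ∧ z = u / v

variable {K} {b c : ℕ} {z w : ℂ}

theorem FracBounded.mono (h : FracBounded K b z) (hbc : b ≤ c) : FracBounded K c z := by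
  obtain ⟨u, v, hu, hv, hv0, hb, rfl⟩ := h
  have : (2 : ℝ) ^ b ≤ 2 ^ c := pow_le_pow_right₀ (by norm_num) hbc
  exact ⟨u, v, hu, hv, hv0, fun σ => ⟨(hb σ).1.trans this, (hb σ).2.trans this⟩, rfl⟩

theorem fracBounded_zero : FracBounded K b 0 :=
  ⟨0, 1, isIntegral_zero, isIntegral_one, one_ne_zero,
    fun σ => by simp; exact one_le_pow₀ (by norm_num), by simp⟩

theorem fracBounded_one : FracBounded K b 1 :=
  ⟨1, 1, isIntegral_one, isIntegral_one, one_ne_zero,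
    fun σ => by simp; exact one_le_pow₀ (by norm_num), by simp⟩

theorem FracBounded.mul (hz : FracBounded K b z) (hw : FracBounded K c w) :
    FracBounded K (b + c) (z * w) := by
  obtain ⟨u, v, hu, hv, hv0, hb, rfl⟩ := hz
  obtain ⟨u', v', hu', hv', hv0', hb', rfl⟩ := hw
  refine ⟨u * u', v * v', hu.mul hu', hv.mul hv', mul_ne_zero hv0 hv0', fun σ => ?_, ?_⟩
  · rw [map_mul, map_mul, norm_mul, norm_mul, pow_add]
    exact ⟨mul_le_mul (hb σ).1 (hb' σ).1 (norm_nonneg _) (by positivity),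
      mul_le_mul (hb σ).2 (hb' σ).2 (norm_nonneg _) (by positivity)⟩
  · push_cast
    rw [div_mul_div_comm]

theorem FracBounded.inv (hz : FracBounded K b z) : FracBounded K b z⁻¹ := by
  obtain ⟨u, v, hu, hv, hv0, hb, rfl⟩ := hz
  -- The convention `0⁻¹ = 0` covers divisions by zero inside straight-line programs.
  by_cases hu0 : u = 0
  · subst hu0
    simpa using fracBounded_zero
  · exact ⟨v, u, hv, hu, hu0, fun σ => (hb σ).symm, by rw [inv_div]⟩

theorem FracBounded.neg (hz : FracBounded K b z) : FracBounded K b (-z) := by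
  obtain ⟨u, v, hu, hv, hv0, hb, rfl⟩ := hz
  exact ⟨-u, v, hu.neg, hv, hv0, fun σ => by simpa using hb σ, by push_cast; rw [neg_div]⟩

theorem FracBounded.div (hz : FracBounded K b z) (hw : FracBounded K c w) :
    FracBounded K (b + c) (z / w) := by
  rw [div_eq_mul_inv]
  exact hz.mul hw.inv

theorem FracBounded.add (hz : FracBounded K b z) (hw : FracBounded K c w) :
    FracBounded K (b + c + 1) (z + w) := by
  obtain ⟨u, v, hu, hv, hv0, hb, rfl⟩ := hz
  obtain ⟨u', v', hu', hv', hv0', hb', rfl⟩ := hw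
  refine ⟨u * v' + v * u', v * v', (hu.mul hv').add (hv.mul hu'), hv.mul hv',
    mul_ne_zero hv0 hv0', fun σ => ?_, ?_⟩
  · have h1 : ‖σ u‖ * ‖σ v'‖ ≤ 2 ^ b * 2 ^ c :=
      mul_le_mul (hb σ).1 (hb' σ).2 (norm_nonneg _) (by positivity)
    have h2 : ‖σ v‖ * ‖σ u'‖ ≤ 2 ^ b * 2 ^ c :=
      mul_le_mul (hb σ).2 (hb' σ).1 (norm_nonneg _) (by positivity)
    have h3 : ‖σ v‖ * ‖σ v'‖ ≤ 2 ^ b * 2 ^ c :=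
      mul_le_mul (hb σ).2 (hb' σ).2 (norm_nonneg _) (by positivity)
    have h4 : (0 : ℝ) < 2 ^ b * 2 ^ c := by positivity
    rw [pow_succ, pow_add]
    constructor
    · rw [map_add, map_mul, map_mul]
      refine (norm_add_le _ _).trans ?_
      rw [norm_mul, norm_mul]
      linarith
    · rw [map_mul, norm_mul]
      linarith
  · have hv0C : (v : ℂ) ≠ 0 := by simpa using hv0
    have hv0C' : (v' : ℂ) ≠ 0 := by simpa using hv0'
    push_cast
    rw [div_add_div _ _ hv0C hv0C']

theorem FracBounded.sub (hz : FracBounded K b z) (hw : FracBounded K c w) :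
    FracBounded K (b + c + 1) (z - w) := by
  rw [sub_eq_add_neg]
  exact hz.add hw.neg

theorem FracBounded.finsetProd {ι : Type*} (s : Finset ι) (f : ι → ℂ)
    (h : ∀ i ∈ s, FracBounded K b (f i)) : FracBounded K (s.card * b) (∏ i ∈ s, f i) := by
  classical
  induction s using Finset.induction_on with
  | empty => simpa using fracBounded_one
  | insert i s hi ih =>
    rw [Finset.prod_insert hi, Finset.card_insert_of_notMem hi]
    exact ((h i (by simp)).mul (ih fun j hj => h j (by simp [hj]))).mono (by ring_nf; rfl)

theorem FracBounded.finsetSum {ι : Type*} (s : Finset ι) (f : ι → ℂ)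
    (h : ∀ i ∈ s, FracBounded K b (f i)) : FracBounded K (s.card * (b + 1)) (∑ i ∈ s, f i) := by
  classical
  induction s using Finset.induction_on with
  | empty => simpa using fracBounded_zero
  | insert i s hi ih =>
    rw [Finset.sum_insert hi, Finset.card_insert_of_notMem hi]
    exact ((h i (by simp)).add (ih fun j hj => h j (by simp [hj]))).mono (by ring_nf; rfl)

/-- A nonzero algebraic integer with bounded conjugates is not small. -/
theorem two_pow_le_norm_mul {L : Type*} [Field L] [Algebra ℚ L] [FiniteDimensional ℚ L]
    (φ : L →ₐ[ℚ] ℂ) {u : L} (hu : IsIntegral ℤ u) (hu0 : u ≠ 0)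
    (hb : ∀ σ : L →+* ℂ, ‖σ u‖ ≤ 2 ^ b) : (2 : ℝ) ^ b ≤ ‖φ u‖ * 2 ^ (b * finrank ℚ L) := by
  classical
  -- The product of all conjugates is the norm, a nonzero rational integer. Bounding all factors
  -- except the one at `φ` by 2^b then bounds that one from below.
  have hnorm : (1 : ℝ) ≤ ∏ σ : L →ₐ[ℚ] ℂ, ‖σ u‖ := by
    rw [← norm_prod, ← Algebra.norm_eq_prod_embeddings ℚ ℂ u]
    have hint : IsIntegral ℤ (Algebra.norm ℚ u) := Algebra.isIntegral_norm ℚ hu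
    obtain ⟨m, hm⟩ := IsIntegrallyClosed.isIntegral_iff.1 hint
    have hm0 : m ≠ 0 := by
      rintro rfl
      rw [map_zero, eq_comm, Algebra.norm_eq_zero_iff] at hm
      exact hu0 hm
    rw [← hm]
    have : (1 : ℝ) ≤ |(m : ℝ)| := by exact_mod_cast Int.one_le_abs hm0
    simpa using this
  rw [← Finset.mul_prod_erase Finset.univ _ (Finset.mem_univ φ)] at hnorm
  have hprod : ∏ σ ∈ Finset.univ.erase φ, ‖σ u‖ ≤ ((2 : ℝ) ^ b) ^ (finrank ℚ L - 1) := by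
    have h : ∏ σ ∈ Finset.univ.erase φ, ‖σ u‖ ≤ ∏ σ ∈ Finset.univ.erase φ, (2 : ℝ) ^ b :=
      Finset.prod_le_prod (fun _ _ => norm_nonneg _) fun σ _ => hb (σ : L →+* ℂ)
    refine h.trans ?_
    rw [Finset.prod_const, Finset.card_erase_of_mem (Finset.mem_univ _), Finset.card_univ,
      AlgHom.card]
  have hD : 0 < finrank ℚ L := finrank_pos
  have h1 : (2 : ℝ) ^ (b * finrank ℚ L) = ((2 : ℝ) ^ b) ^ (finrank ℚ L - 1) * 2 ^ b := by
    rw [← pow_succ, Nat.sub_add_cancel hD, pow_mul]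
  have h2 := hnorm.trans (mul_le_mul_of_nonneg_left hprod (norm_nonneg _))
  rw [h1, ← mul_assoc]
  exact le_mul_of_one_le_left (by positivity) h2

/-- The numerator is at most 2^b, and the denominator is not small by `two_pow_le_norm_mul`. -/
theorem FracBounded.norm_le [FiniteDimensional ℚ K] (h : FracBounded K b z) :
    ‖z‖ ≤ 2 ^ (b * finrank ℚ K) := by
  obtain ⟨u, v, hu, hv, hv0, hb, rfl⟩ := h
  have h1 := two_pow_le_norm_mul K.val hv hv0 fun σ => (hb σ).2
  have h2 : ‖(u : ℂ)‖ ≤ 2 ^ b := (hb (K.val : K →+* ℂ)).1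
  rw [norm_div, div_le_iff₀ (by simpa using hv0), mul_comm]
  exact h2.trans h1

/-- The class is closed under inversion, so this is the upper bound for `z⁻¹`. -/
theorem FracBounded.le_norm [FiniteDimensional ℚ K] (h : FracBounded K b z) (hz : z ≠ 0) :
    1 ≤ ‖z‖ * 2 ^ (b * finrank ℚ K) := by
  have h1 := h.inv.norm_le
  rw [norm_inv] at h1
  have h2 : 0 < ‖z‖ := norm_pos_iff.2 hz
  calc 1 = ‖z‖ * ‖z‖⁻¹ := (mul_inv_cancel₀ h2.ne').symm
    _ ≤ _ := by gcongr

end Size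

/-! ### Roots of integer polynomials -/

section Roots

open Polynomial Module

/-- The integer polynomial with the given coefficients, constant term first. -/
noncomputable def hornerPoly : List ℤ → ℤ[X]
  | [] => 0
  | c :: p => C c + X * hornerPoly p

theorem aeval_hornerPoly (p : List ℤ) (z : ℂ) : aeval z (hornerPoly p) = hornerEval p z := by
  induction p with
  | nil => simp [hornerPoly, hornerEval]
  | cons c p ih =>
    rw [hornerPoly, map_add, map_mul, ih, aeval_X]
    simp [hornerEval]

theorem coeff_hornerPoly (p : List ℤ) (i : ℕ) : (hornerPoly p).coeff i = p.getD i 0 := by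
  induction p generalizing i with
  | nil => simp [hornerPoly]
  | cons c p ih =>
    cases i with
    | zero => simp [hornerPoly]
    | succ i => rw [hornerPoly, coeff_add, coeff_C_succ, coeff_X_mul, ih]; simp

theorem natDegree_hornerPoly_le (p : List ℤ) : (hornerPoly p).natDegree ≤ p.length := by
  rw [natDegree_le_iff_coeff_eq_zero]
  intro i hi
  rw [coeff_hornerPoly, List.getD_eq_default _ _ hi.le]

/-- For the zero polynomial the centre of the disc and a point half a radius away would be two
roots. -/
theorem hornerPoly_ne_zero {p : List ℤ} {a b : ℤ} {d : ℕ} (h : ∃! z, IsRootInDisc p a b d z) :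
    hornerPoly p ≠ 0 := by
  intro h0
  obtain ⟨z, hz, hu⟩ := h
  have hroot : ∀ w, hornerEval p w = 0 := fun w => by rw [← aeval_hornerPoly, h0]; simp
  set c : ℂ := ((a : ℂ) + (b : ℂ) * Complex.I) / (d : ℂ) with hc
  have hr : (0 : ℝ) < 1 / (d : ℝ) := lt_of_le_of_lt (norm_nonneg _) hz.2
  have h1 : c = z := hu c ⟨hroot _, by rw [← hc, sub_self, norm_zero]; exact hr⟩
  have h2 : c + ((1 / (d : ℝ) / 2 : ℝ) : ℂ) = z := by
    refine hu _ ⟨hroot _, ?_⟩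
    rw [← hc, add_sub_cancel_left, Complex.norm_real, Real.norm_of_nonneg (by positivity)]
    linarith
  have h3 : ((1 / (d : ℝ) / 2 : ℝ) : ℂ) = 0 := by
    rw [← h1] at h2
    simpa using h2
  rw [Complex.ofReal_eq_zero] at h3
  linarith

/-- Cauchy's root bound, multiplied by the leading coefficient: both resulting summands are at most
`B`. -/
theorem norm_leadingCoeff_mul_root_le {P : ℤ[X]} (hP : P ≠ 0) {z : ℂ} (hz : aeval z P = 0)
    {B : ℝ} (hB : ∀ i, |(P.coeff i : ℝ)| ≤ B) : ‖(P.leadingCoeff : ℂ) * z‖ ≤ 2 * B := by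
  have hinj : Function.Injective (Int.castRingHom ℂ) := Int.cast_injective
  set Q : ℂ[X] := P.map (Int.castRingHom ℂ) with hQ
  have hQ0 : Q ≠ 0 := (Polynomial.map_ne_zero_iff hinj).2 hP
  have hroot : Q.IsRoot z := by
    rw [IsRoot, hQ, eval_map, ← hz]; rfl
  have hlt := hroot.norm_lt_cauchyBound hQ0
  have hlc : Q.leadingCoeff = (P.leadingCoeff : ℂ) := by
    rw [hQ, leadingCoeff_map_of_injective hinj]; rfl
  have hcoeff : ∀ i, ‖Q.coeff i‖ ≤ B := fun i => by
    rw [hQ, coeff_map, eq_intCast, Complex.norm_intCast]; exact hB i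
  have hB0 : 0 ≤ B := (norm_nonneg _).trans (hcoeff 0)
  have hlc0 : 0 < ‖Q.leadingCoeff‖ := norm_pos_iff.2 (leadingCoeff_ne_zero.2 hQ0)
  have hsup : (((Finset.range Q.natDegree).sup (‖Q.coeff ·‖₊) : NNReal) : ℝ) ≤ B := by
    have : (Finset.range Q.natDegree).sup (‖Q.coeff ·‖₊) ≤ ⟨B, hB0⟩ :=
      Finset.sup_le fun i _ => hcoeff i
    exact this
  have hcb : (cauchyBound Q : ℝ) =
      ((Finset.range Q.natDegree).sup (‖Q.coeff ·‖₊) : NNReal) / ‖Q.leadingCoeff‖ + 1 := by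
    simp [cauchyBound]
  rw [← hlc, norm_mul]
  have h1 : ‖Q.leadingCoeff‖ * ‖z‖ ≤ ‖Q.leadingCoeff‖ * cauchyBound Q :=
    mul_le_mul_of_nonneg_left (by exact_mod_cast hlt.le) hlc0.le
  have h2 : ‖Q.leadingCoeff‖ * cauchyBound Q =
      ((Finset.range Q.natDegree).sup (‖Q.coeff ·‖₊) : NNReal) + ‖Q.leadingCoeff‖ := by
    rw [hcb]; field_simp
  have h3 : ‖Q.leadingCoeff‖ ≤ B := hcoeff _
  linarith

/-- Write z as (a z)/a with a the leading coefficient. Then a z is an algebraic integer, and its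
conjugates are a times roots of the same polynomial, so the Cauchy bound applies to all of them. -/
theorem fracBounded_root {K : IntermediateField ℚ ℂ} {P : ℤ[X]} (hP : P ≠ 0) {z : ℂ}
    (hz : aeval z P = 0) (hzK : z ∈ K) {b : ℕ} (hb : ∀ i, |(P.coeff i : ℝ)| ≤ 2 ^ b) :
    FracBounded K (b + 1) z := by
  have hzK0 : aeval (⟨z, hzK⟩ : K) P = 0 := by
    apply (algebraMap K ℂ).injective
    rw [map_zero, ← hz, ← aeval_algebraMap_apply]
    rfl
  have hint := isIntegral_leadingCoeff_smul P (⟨z, hzK⟩ : K) hzK0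
  have hlc : (P.leadingCoeff : K) ≠ 0 := by exact_mod_cast leadingCoeff_ne_zero.2 hP
  rw [zsmul_eq_mul] at hint
  refine ⟨_, (P.leadingCoeff : K), hint, isIntegral_algebraMap (R := ℤ) (x := P.leadingCoeff), hlc,
    fun σ => ⟨?_, ?_⟩, ?_⟩
  · have hσ : aeval (σ ⟨z, hzK⟩) P = 0 := by
      have := congrArg σ hzK0
      rwa [map_zero, aeval_def, hom_eval₂, show (σ.comp (algebraMap ℤ K)) = algebraMap ℤ ℂ from
        RingHom.ext_int _ _, ← aeval_def] at this
    have := norm_leadingCoeff_mul_root_le hP hσ hb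
    rw [map_mul, map_intCast, pow_succ, mul_comm _ (2 : ℝ)]
    exact this
  · rw [map_intCast, Complex.norm_intCast]
    exact (hb _).trans (pow_le_pow_right₀ (by norm_num) (by omega))
  · have : (P.leadingCoeff : ℂ) ≠ 0 := by exact_mod_cast leadingCoeff_ne_zero.2 hP
    push_cast
    rw [mul_div_cancel_left₀ _ this]

end Roots

/-! ### Size of the numbers in a frame -/

theorem length_le_length_encList {α : Type} {enc : α → List Bool} {l : List α} {a : α}
    (h : a ∈ l) : (enc a).length ≤ (encList enc l).length := by
  induction l with
  | nil => simp at h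
  | cons b l ih =>
    simp only [encList, List.length_cons, List.length_append]
    rcases List.mem_cons.1 h with rfl | h
    · omega
    · have := ih h; omega

theorem length_lt_length_encList {α : Type} (enc : α → List Bool) (l : List α) :
    l.length < (encList enc l).length := by
  induction l with
  | nil => simp [encList]
  | cons b l ih => simp only [encList, List.length_cons, List.length_append]; omega

theorem abs_le_two_pow_encInt (c : ℤ) : |(c : ℝ)| ≤ 2 ^ (encInt c).length := by
  have h1 : c.natAbs < 2 ^ c.natAbs.size := Nat.lt_size_self _
  have h2 : c.natAbs.size ≤ (encInt c).length := by
    have := length_lt_length_encList (fun b => [b]) c.natAbs.bits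
    rw [Nat.size_eq_bits_len] at this
    rw [encInt, List.length_cons, encNat]
    omega
  have h3 : c.natAbs ≤ 2 ^ (encInt c).length :=
    h1.le.trans (Nat.pow_le_pow_right (by norm_num) h2)
  rw [← Int.cast_abs, ← Int.natCast_natAbs]
  exact_mod_cast h3

/-- If the line is a root line, then its result lies in `K`. -/
def Line.RootIn (K : IntermediateField ℚ ℂ) : Line → Prop
  | .root p a b d => (Line.root p a b d).result [] ∈ K
  | .op _ _ _ => True

theorem Line.fracBounded_result {K : IntermediateField ℚ ℂ} {l : Line} (hl : l.RootIn K)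
    {env : List ℂ} {b : ℕ} (h : ∀ z ∈ env, FracBounded K b z) :
    FracBounded K (2 * b + 1 + (encLine l).length) (l.result env) := by
  have hget : ∀ i, FracBounded K b (env.getD i 0) := by
    intro i
    by_cases hi : i < env.length
    · rw [List.getD_eq_getElem _ _ hi]; exact h _ (List.getElem_mem hi)
    · rw [List.getD_eq_default _ _ (by omega)]; exact fracBounded_zero
  cases l with
  | root p x y d =>
    rw [Line.RootIn, Line.result] at hl
    rw [Line.result]
    split_ifs at hl ⊢ with hu
    · refine (fracBounded_root (b := (encList encInt p).length) (hornerPoly_ne_zero hu)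
        ((aeval_hornerPoly _ _).trans hu.choose_spec.1.1) hl fun i => ?_).mono ?_
      · rw [coeff_hornerPoly]
        by_cases hi : i < p.length
        · rw [List.getD_eq_getElem _ _ hi]
          exact (abs_le_two_pow_encInt _).trans (pow_le_pow_right₀ (by norm_num)
            (length_le_length_encList (List.getElem_mem hi)))
        · rw [List.getD_eq_default _ _ (by omega)]
          simp
      · simp [encLine]; omega
    · exact fracBounded_zero
  | op o i j =>
    have hb : b + b + 1 ≤ 2 * b + 1 + (encLine (.op o i j)).length := by omega
    cases o
    · exact ((hget i).add (hget j)).mono hb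
    · exact ((hget i).sub (hget j)).mono hb
    · exact ((hget i).mul (hget j)).mono (by omega)
    · exact ((hget i).div (hget j)).mono (by omega)

/-- A line turns the exponent b into at most 2b + 1 + |line|, so b + 1 is multiplied by at most
2^(|line| + 1), where |line| + 1 is exactly what the line with its announcing bit adds to the code
length. -/
theorem NumCode.fracBounded_value {K : IntermediateField ℚ ℂ} {s : NumCode}
    (hs : ∀ l ∈ s, l.RootIn K) : FracBounded K (2 ^ (encNum s).length) s.value := by
  have h : ∀ (s : NumCode) (env : List ℂ) (b : ℕ), (∀ l ∈ s, l.RootIn K) →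
      (∀ z ∈ env, FracBounded K b z) →
      ∀ z ∈ s.foldl (fun env l => l.result env :: env) env,
        FracBounded K ((b + 1) * 2 ^ (encNum s).length) z := by
    intro s
    induction s with
    | nil =>
      intro env b _ h z hz
      exact (h z hz).mono (by simp [encNum, encList]; omega)
    | cons l s ih =>
      intro env b hs h z hz
      refine (ih (l.result env :: env) (2 * b + 1 + (encLine l).length)
        (fun l' hl' => hs l' (by simp [hl'])) (fun w hw => ?_) z hz).mono ?_
      · rcases List.mem_cons.1 hw with rfl | hw
        · exact l.fracBounded_result (hs l (by simp)) h
        · exact (h w hw).mono (by omega)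
      · simp only [encNum, encList, List.length_cons, List.length_append]
        rw [show (encLine l).length + (encList encLine s).length + 1 =
          (encList encLine s).length + ((encLine l).length + 1) by ring, pow_add, ← mul_assoc,
          mul_right_comm]
        refine Nat.mul_le_mul_right _ ?_
        have h2 : (encLine l).length + 2 ≤ 2 ^ ((encLine l).length + 1) :=
          Nat.succ_le_of_lt Nat.lt_two_pow_self
        calc 2 * b + 1 + (encLine l).length + 1 ≤ (b + 1) * ((encLine l).length + 2) := by
              nlinarith [Nat.zero_le (b * (encLine l).length)]
          _ ≤ _ := Nat.mul_le_mul_left _ h2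
  have h' := h s [] 0 hs (by simp)
  change ∀ z ∈ s.results, _ at h'
  unfold NumCode.value
  cases hr : s.results with
  | nil => exact fracBounded_zero
  | cons w ws => simpa using h' w (by rw [hr]; simp)

open Module in
-- The compositum of the fields generated by the single roots: degrees multiply at most, and each is
-- bounded by the length of the coefficient list. Operations need no extension.
theorem exists_field_rootIn (ls : List Line) : ∃ K : IntermediateField ℚ ℂ,
    FiniteDimensional ℚ K ∧ finrank ℚ K ≤ 2 ^ (ls.map fun l => (encLine l).length).sum ∧
      ∀ l ∈ ls, l.RootIn K := by
  induction ls with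
  | nil => exact ⟨⊥, inferInstance, by simp, by simp⟩
  | cons l ls ih =>
    obtain ⟨K, hfin, hK, hls⟩ := ih
    obtain ⟨E, hE, hEle, hl⟩ : ∃ E : IntermediateField ℚ ℂ, FiniteDimensional ℚ E ∧
        finrank ℚ E ≤ 2 ^ (encLine l).length ∧ l.RootIn E := by
      cases l with
      | op o i j =>
        exact ⟨⊥, inferInstance, by simpa using Nat.one_le_two_pow, trivial⟩
      | root p a b d =>
        by_cases hu : ∃! z, IsRootInDisc p a b d z
        · set z := hu.choose with hz
          have hroot : Polynomial.aeval z (hornerPoly p) = 0 :=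
            (aeval_hornerPoly _ _).trans hu.choose_spec.1.1
          have hQ0 : (hornerPoly p).map (algebraMap ℤ ℚ) ≠ 0 :=
            (Polynomial.map_ne_zero_iff (RingHom.injective_int _)).2 (hornerPoly_ne_zero hu)
          have hQ : Polynomial.aeval z ((hornerPoly p).map (algebraMap ℤ ℚ)) = 0 := by
            rw [Polynomial.aeval_map_algebraMap, hroot]
          have hint : IsIntegral ℚ z := isAlgebraic_iff_isIntegral.1 ⟨_, hQ0, hQ⟩
          refine ⟨IntermediateField.adjoin ℚ {z},
            IntermediateField.adjoin.finiteDimensional hint, ?_, ?_⟩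
          · rw [IntermediateField.adjoin.finrank hint]
            refine (Polynomial.natDegree_le_natDegree
              (minpoly.degree_le_of_ne_zero ℚ z hQ0 hQ)).trans ?_
            refine Polynomial.natDegree_map_le.trans ((natDegree_hornerPoly_le p).trans ?_)
            refine le_trans ?_ Nat.lt_two_pow_self.le
            have := length_lt_length_encList encInt p
            simp only [encLine, List.length_cons, List.length_append]
            omega
          · rw [Line.RootIn, Line.result, dif_pos hu]
            exact IntermediateField.mem_adjoin_simple_self ℚ z
        · refine ⟨⊥, inferInstance, by simpa using Nat.one_le_two_pow, ?_⟩
          rw [Line.RootIn, Line.result, dif_neg hu]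
          exact zero_mem _
    have hmono : ∀ {E F : IntermediateField ℚ ℂ} {l : Line}, E ≤ F → l.RootIn E → l.RootIn F := by
      intro E F l hEF h
      cases l with
      | op o i j => trivial
      | root p a b d => exact hEF h
    refine ⟨E ⊔ K, IntermediateField.finiteDimensional_sup E K, ?_, ?_⟩
    · rw [List.map_cons, List.sum_cons, pow_add]
      exact (IntermediateField.finrank_sup_le E K).trans (Nat.mul_le_mul hEle hK)
    · intro l' hl'
      rcases List.mem_cons.1 hl' with rfl | hl'
      · exact hmono le_sup_left hl
      · exact hmono le_sup_right (hls l' hl')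

theorem sum_length_flatMap_le {α : Type} {enc : α → List Bool} {f : α → List Line}
    (h : ∀ a, ((f a).map fun l => (encLine l).length).sum ≤ (enc a).length) (l : List α) :
    ((l.flatMap f).map fun l => (encLine l).length).sum ≤ (encList enc l).length := by
  induction l with
  | nil => simp
  | cons a l ih =>
    have := h a
    simp only [List.flatMap_cons, List.map_append, List.sum_append, encList, List.length_cons,
      List.length_append]
    omega

open Module in
-- One field must serve all nodes, because the value of the frame mixes their numbers. Its degree
-- stays controlled because the lengths of all lines add up to at most the code length.
theorem FrameCode.exists_field (c : FrameCode) : ∃ K : IntermediateField ℚ ℂ,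
    FiniteDimensional ℚ K ∧ finrank ℚ K ≤ 2 ^ (encFrame c).length ∧
      ∀ v ∈ c.nodes, ∀ y, FracBounded K (2 ^ (encFrame c).length) (v.table y).value := by
  obtain ⟨K, hfin, hK, h⟩ := exists_field_rootIn
    (c.nodes.flatMap fun v : NodeCode c.n => ((boolVectors v.arity).map v.table).flatMap fun s => s)
  have hlen : (encList encNode c.nodes).length ≤ (encFrame c).length := by
    rw [encFrame, List.length_append]; omega
  refine ⟨K, hfin, hK.trans (Nat.pow_le_pow_right (by norm_num) (le_trans ?_ hlen)), ?_⟩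
  · refine sum_length_flatMap_le (fun v => ?_) _
    rw [encNode, List.length_append]
    refine (sum_length_flatMap_le (enc := encNum) (fun s => ?_) _).trans (Nat.le_add_left _ _)
    have := sum_length_flatMap_le (enc := encLine) (f := fun l => [l]) (by simp) s
    simpa [encNum] using this
  · intro v hv y
    have hmem : v.table y ∈ (boolVectors v.arity).map v.table :=
      List.mem_map_of_mem (mem_boolVectors y)
    refine (NumCode.fracBounded_value fun l hl => h l ?_).mono
      (Nat.pow_le_pow_right (by norm_num) ?_)
    · exact List.mem_flatMap.2 ⟨v, hv, List.mem_flatMap.2 ⟨_, hmem, hl⟩⟩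
    · refine (length_le_length_encList hmem).trans (le_trans ?_ hlen)
      refine le_trans ?_ (length_le_length_encList hv)
      rw [encNode, List.length_append]; omega

/-! ### Values of perturbed frames -/

/-- The polynomial is 4z - 1. Starting from 1/4 = (1/2)^2 makes the perturbation the square of the
cutoff threshold. -/
theorem Line.result_quarter (env : List ℂ) : (Line.root [-1, 4] 0 0 1).result env = 1 / 4 := by
  have hz : IsRootInDisc [-1, 4] 0 0 1 (1 / 4) := by
    constructor
    · simp [hornerEval]
    · norm_num
  have hu : ∀ w, IsRootInDisc [-1, 4] 0 0 1 w → w = 1 / 4 := by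
    intro w hw
    have := hw.1
    simp [hornerEval] at this
    linear_combination (1 / 4) * this
  have hex : ∃! z, IsRootInDisc [-1, 4] 0 0 1 z := ⟨_, hz, hu⟩
  rw [Line.result, dif_pos hex]
  exact hu _ hex.choose_spec.1

theorem foldl_result_square (n : ℕ) (x : ℂ) (env : List ℂ) : ∃ pre : List ℂ, pre.length = n ∧
    (List.replicate n (Line.op .mul 0 0)).foldl (fun env l => l.result env :: env) (x :: env) =
      x ^ 2 ^ n :: (pre ++ env) := by
  induction n generalizing x env with
  | zero => exact ⟨[], rfl, by simp⟩
  | succ n ih =>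
    obtain ⟨pre, hpre, h⟩ := ih (x * x) (x :: env)
    refine ⟨pre ++ [x], by simp [hpre], ?_⟩
    rw [List.replicate_succ, List.foldl_cons]
    change List.foldl _ (x * x :: x :: env) _ = _
    rw [h, pow_succ' 2 n, pow_mul, sq]
    simp

theorem NumCode.value_perturb (N : ℕ) (s : NumCode) :
    (s.perturb N).value = s.value + (1 / 4) ^ 2 ^ N := by
  unfold NumCode.value
  generalize hr : s.results = r
  unfold NumCode.results at hr
  unfold NumCode.results NumCode.perturb
  rw [List.foldl_append, hr, List.foldl_cons, Line.result_quarter, List.foldl_append]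
  obtain ⟨pre, hpre, h⟩ := foldl_result_square N (1 / 4) r
  rw [h]
  simp only [List.foldl_cons, List.foldl_nil, Line.result, ArithOp.apply, List.getD_cons_zero,
    List.getD_cons_succ]
  -- The reference `N + 1` skips the final power and the `N` earlier powers, and so reaches the old
  -- result. For the empty program it points nowhere and gives the default `0`, which is the value
  -- of that program.
  rw [List.getD_append_right _ _ _ _ hpre.le, hpre, Nat.sub_self, add_comm]

/-! ### Effect of the perturbation on the value and the labels of a frame. -/

theorem FrameCode.csp_frame (c : FrameCode) : c.frame.csp =
    ∑ σ : Fin c.n → Bool, (c.nodes.map fun v => (v.table fun i => σ (v.scope i)).value).prod := by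
  unfold ConstraintFrame.csp
  refine Finset.sum_congr rfl fun σ _ => ?_
  rw [← Fin.prod_univ_fun_getElem]
  rfl

theorem FrameCode.csp_frame_perturb (c : FrameCode) (N : ℕ) : (c.perturb N).frame.csp =
    ∑ σ : Fin c.n → Bool,
      (c.nodes.map fun v => ((v.perturb N).table fun i => σ (v.scope i)).value).prod := by
  refine (FrameCode.csp_frame _).trans (Finset.sum_congr rfl fun σ _ => ?_)
  exact congrArg List.prod List.map_map

/-- Factors are replaced one at a time. The induction closes with this form of the bound since
(A+1)((A+1)^m - A^m) + A^m = (A+1)^(m+1) - A^(m+1). -/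
theorem norm_list_prod_sub_le {α : Type*} {l : List α} {f g : α → ℂ} {A r : ℝ} (hr : 0 ≤ r)
    (hr1 : r ≤ 1) (hf : ∀ a ∈ l, ‖f a‖ ≤ A) (hg : ∀ a ∈ l, ‖g a - f a‖ ≤ r) (hA : 0 ≤ A) :
    ‖(l.map f).prod‖ ≤ A ^ l.length ∧
      ‖(l.map g).prod - (l.map f).prod‖ ≤ r * ((A + 1) ^ l.length - A ^ l.length) := by
  induction l with
  | nil => simp
  | cons a l ih =>
    obtain ⟨h1, h2⟩ := ih (fun b hb => hf b (by simp [hb])) fun b hb => hg b (by simp [hb])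
    have hfa := hf a (by simp)
    have hga := hg a (by simp)
    have hga' : ‖g a‖ ≤ A + 1 := by
      have := norm_add_le (g a - f a) (f a)
      rw [sub_add_cancel] at this
      linarith
    simp only [List.map_cons, List.prod_cons, List.length_cons]
    constructor
    · rw [norm_mul, pow_succ']
      exact mul_le_mul hfa h1 (norm_nonneg _) hA
    · rw [show g a * (l.map g).prod - f a * (l.map f).prod =
        g a * ((l.map g).prod - (l.map f).prod) + (g a - f a) * (l.map f).prod by ring]
      refine (norm_add_le _ _).trans ?_
      rw [norm_mul, norm_mul]
      have h3 := mul_le_mul hga' h2 (norm_nonneg _) (by positivity)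
      have h4 := mul_le_mul hga h1 (norm_nonneg _) hr
      calc _ ≤ _ := add_le_add h3 h4
        _ = _ := by ring

theorem FrameCode.norm_csp_perturb_sub_le (c : FrameCode) (N : ℕ) {A : ℝ} (hA : 0 ≤ A)
    (h : ∀ v ∈ c.nodes, ∀ y, ‖(v.table y).value‖ ≤ A) :
    ‖(c.perturb N).frame.csp - c.frame.csp‖ ≤
      2 ^ c.n * ((1 / 4) ^ 2 ^ N * (A + 1) ^ c.nodes.length) := by
  have hr1 : (1 / 4 : ℝ) ^ 2 ^ N ≤ 1 := pow_le_one₀ (by norm_num) (by norm_num)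
  rw [FrameCode.csp_frame_perturb, FrameCode.csp_frame, ← Finset.sum_sub_distrib]
  refine (norm_sum_le _ _).trans ?_
  refine (Finset.sum_le_card_nsmul _ _ ((1 / 4) ^ 2 ^ N * (A + 1) ^ c.nodes.length)
    fun σ _ => ?_).trans ?_
  · refine (norm_list_prod_sub_le (by positivity) hr1 (fun v hv => h v hv _)
      (fun v hv => ?_) hA).2.trans ?_
    · simp only [NodeCode.perturb]
      split_ifs
      · rw [NumCode.value_perturb, add_sub_cancel_left, norm_pow]
        norm_num
      · rw [sub_self, norm_zero]
        positivity
    · gcongr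
      exact sub_le_self _ (by positivity)
  · simp

theorem NodeCode.constraint_perturb_mem {n N : ℕ} {v : NodeCode n} {F : Set Constraint}
    (hv : v.constraint ∈ F ∪ unaryConstraints)
    (h : ∀ y, (v.table y).value + (1 / 4) ^ 2 ^ N ≠ 0) :
    (v.perturb N).constraint ∈ F ∪ (unaryConstraints ∩ nonzeroConstraints) := by
  by_cases h1 : v.arity = 1
  · refine Or.inr ⟨h1, h1.ge, fun y => ?_⟩
    change (if v.arity = 1 then NumCode.perturb N (v.table y) else v.table y).value ≠ 0
    rw [if_pos h1, NumCode.value_perturb]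
    exact h y
  · refine Or.inl ?_
    have : v.perturb N = v := by
      obtain ⟨k, sc, t⟩ := v
      simp only at h1
      simp [NodeCode.perturb, h1]
    rw [this]
    exact hv.resolve_right h1

/-- If the perturbation is doubly exponentially small in the length of the code, then it is small
compared with all values that occur. -/
theorem FrameCode.perturb_bounds (c : FrameCode) {ℓ : ℕ} (hℓ : ℓ = (encFrame c).length) (N : ℕ) :
    (c.frame.csp ≠ 0 → 1 ≤ ‖c.frame.csp‖ * 2 ^ 2 ^ (4 * ℓ + 1)) ∧
    ‖(c.perturb N).frame.csp - c.frame.csp‖ ≤ (1 / 4) ^ 2 ^ N * 2 ^ 2 ^ (4 * ℓ + 1) ∧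
    ∀ v ∈ c.nodes, ∀ y, (v.table y).value ≠ 0 → 1 ≤ ‖(v.table y).value‖ * 2 ^ 2 ^ (4 * ℓ + 1) := by
  obtain ⟨K, hfin, hK, hv⟩ := c.exists_field
  rw [← hℓ] at hK hv
  have hn : c.n ≤ ℓ := by
    rw [hℓ, encFrame, encUnary]; simp
  have hm : c.nodes.length ≤ ℓ := by
    have := length_lt_length_encList encNode c.nodes
    rw [hℓ, encFrame, List.length_append]; omega
  have hℓ2 : ℓ + 1 ≤ 2 ^ ℓ := Nat.lt_two_pow_self
  have hvb : 2 ^ ℓ * Module.finrank ℚ K ≤ 2 ^ (2 * ℓ) := by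
    rw [two_mul, pow_add]; exact Nat.mul_le_mul_left _ hK
  have hle : 2 ^ (2 * ℓ) ≤ 2 ^ (4 * ℓ + 1) := Nat.pow_le_pow_right (by norm_num) (by omega)
  refine ⟨fun h0 => ?_, ?_, fun v hvn y h0 => ?_⟩
  · have hcsp : FracBounded K (2 ^ c.n * (c.nodes.length * 2 ^ ℓ + 1)) c.frame.csp := by
      have := FracBounded.finsetSum (K := K) (b := c.nodes.length * 2 ^ ℓ) Finset.univ
        (fun σ : Fin c.n → Bool => ∏ v : Fin c.nodes.length,
          (c.frame.label v).2 (fun i => σ (c.frame.inc v i))) fun σ _ => by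
            have := FracBounded.finsetProd (K := K) (b := 2 ^ ℓ) Finset.univ
              (fun v : Fin c.nodes.length => (c.frame.label v).2 (fun i => σ (c.frame.inc v i)))
              fun v _ => hv _ (List.get_mem _ v) _
            simpa using this
      exact FracBounded.mono (z := c.frame.csp) this (by simp)
    refine (hcsp.le_norm h0).trans ?_
    gcongr
    · norm_num
    -- There are at most 2^ℓ assignments, each summand contributes at most (ℓ+1) 2^ℓ ≤ 2^ℓ 2^ℓ to
    -- the exponent, and the degree is at most 2^ℓ.
    · calc 2 ^ c.n * (c.nodes.length * 2 ^ ℓ + 1) * Module.finrank ℚ K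
          ≤ 2 ^ ℓ * (2 ^ ℓ * 2 ^ ℓ) * 2 ^ ℓ := by
            refine Nat.mul_le_mul (Nat.mul_le_mul (Nat.pow_le_pow_right (by norm_num) hn) ?_) hK
            have h1 := Nat.mul_le_mul_right (2 ^ ℓ) hm
            have h2 := Nat.mul_le_mul_right (2 ^ ℓ) hℓ2
            have h3 : 1 ≤ 2 ^ ℓ := Nat.one_le_two_pow
            rw [add_mul] at h2
            omega
        _ = 2 ^ (4 * ℓ) := by ring
        _ ≤ _ := Nat.pow_le_pow_right (by norm_num) (by omega)
  · refine (c.norm_csp_perturb_sub_le N (A := 2 ^ 2 ^ (2 * ℓ)) (by positivity)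
      fun v hvn y => ((hv v hvn y).norm_le.trans
        (pow_le_pow_right₀ (by norm_num) hvb))).trans ?_
    have h1 : ((2 : ℝ) ^ 2 ^ (2 * ℓ) + 1) ≤ 2 ^ (2 ^ (2 * ℓ) + 1) := by
      have : (1 : ℝ) ≤ 2 ^ 2 ^ (2 * ℓ) := one_le_pow₀ (by norm_num)
      rw [pow_succ]; linarith
    have h2 : ((2 : ℝ) ^ 2 ^ (2 * ℓ) + 1) ^ c.nodes.length ≤ 2 ^ ((2 ^ (2 * ℓ) + 1) * ℓ) := by
      rw [pow_mul _ (2 ^ (2 * ℓ) + 1) ℓ]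
      refine (pow_le_pow_left₀ (by positivity) h1 _).trans ?_
      exact pow_le_pow_right₀ (one_le_pow₀ (by norm_num)) hm
    have h3 : ℓ + (2 ^ (2 * ℓ) + 1) * ℓ ≤ 2 ^ (4 * ℓ + 1) := by
      have h5 : 1 ≤ 2 ^ (2 * ℓ) := Nat.one_le_two_pow
      have h6 : ℓ ≤ 2 ^ (2 * ℓ) := by
        have : 2 ^ ℓ ≤ 2 ^ (2 * ℓ) := Nat.pow_le_pow_right (by norm_num) (by omega)
        omega
      have h7 : 2 ^ (4 * ℓ + 1) = 2 * (2 ^ (2 * ℓ) * 2 ^ (2 * ℓ)) := by ring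
      rw [h7]
      rcases Nat.eq_zero_or_pos ℓ with h0 | h0
      · subst h0; simp
      · have h8 : 2 ^ 2 ≤ 2 ^ (2 * ℓ) := Nat.pow_le_pow_right (by norm_num) (by omega)
        nlinarith
    calc (2 : ℝ) ^ c.n * ((1 / 4) ^ 2 ^ N * ((2 : ℝ) ^ 2 ^ (2 * ℓ) + 1) ^ c.nodes.length)
        ≤ 2 ^ ℓ * ((1 / 4) ^ 2 ^ N * 2 ^ ((2 ^ (2 * ℓ) + 1) * ℓ)) := by
          gcongr
          norm_num
      _ = (1 / 4) ^ 2 ^ N * 2 ^ (ℓ + (2 ^ (2 * ℓ) + 1) * ℓ) := by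
          rw [pow_add]; ring
      _ ≤ _ := by
          gcongr
          norm_num
  · refine ((hv v hvn y).le_norm h0).trans ?_
    gcongr
    · norm_num
    · exact hvb.trans hle

/-! ### Approximate solutions -/

theorem two_rpow_neg_ge_half {ε : ℝ} (h : ε ≤ 1) : (1 / 2 : ℝ) ≤ 2 ^ (-ε) := by
  calc (1 / 2 : ℝ) = 2 ^ (-1 : ℝ) := by rw [Real.rpow_neg_one]; norm_num
    _ ≤ 2 ^ (-ε) := Real.rpow_le_rpow_of_exponent_le (by norm_num) (by linarith)

/-- Moduli multiply, and arguments add without wrapping around because their sum is at most 1 < π in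
absolute value. -/
theorem IsApproxSolution.trans {ε δ : ℝ} {u v w : ℂ} (hε : ε + δ ≤ 1)
    (h : IsApproxSolution ε u v) (h' : IsApproxSolution δ v w) (hu : u ≠ 0) :
    IsApproxSolution (ε + δ) u w := by
  refine ⟨fun h0 => absurd h0 hu, fun _ => ?_⟩
  obtain ⟨h1, h2, h3⟩ := h.2 hu
  have hvu : v / u ≠ 0 := by
    rw [← norm_pos_iff]; exact lt_of_lt_of_le (by positivity) h1
  have hv : v ≠ 0 := fun h => hvu (by rw [h, zero_div])
  obtain ⟨h1', h2', h3'⟩ := h'.2 hv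
  have hwv : w / v ≠ 0 := by
    rw [← norm_pos_iff]; exact lt_of_lt_of_le (by positivity) h1'
  have heq : w / u = v / u * (w / v) := by field_simp
  have habs : |(v / u).arg + (w / v).arg| ≤ ε + δ := (abs_add_le _ _).trans (add_le_add h3 h3')
  have hpi := Real.pi_gt_three
  have harg : (w / u).arg = (v / u).arg + (w / v).arg := by
    rw [heq, Complex.arg_mul hvu hwv]
    have := abs_le.1 habs
    exact ⟨by linarith [this.1], by linarith [this.2]⟩
  rw [harg, heq, norm_mul, neg_add, Real.rpow_add two_pos, Real.rpow_add two_pos]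
  exact ⟨mul_le_mul h1 h1' (by positivity) (norm_nonneg _),
    mul_le_mul h2 h2' (norm_nonneg _) (by positivity), habs⟩

/-- With v/u = 1 + η, the real and imaginary parts of log(1 + η) are the logarithm of the modulus
and the argument. Both are at most (3/2)|η| ≤ 3ε/8 < ε log 2. -/
theorem isApproxSolution_of_norm_sub_le {ε : ℝ} {u v : ℂ} (hε : ε ≤ 1) (hu : u ≠ 0)
    (h : ‖v - u‖ ≤ ε / 4 * ‖u‖) : IsApproxSolution ε u v := by
  refine ⟨fun h0 => absurd h0 hu, fun _ => ?_⟩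
  have hu' : 0 < ‖u‖ := norm_pos_iff.2 hu
  set η := (v - u) / u with hη
  have hvu : v / u = 1 + η := by rw [hη]; field_simp; ring
  have hn : ‖η‖ ≤ ε / 4 := by rw [hη, norm_div, div_le_iff₀ hu']; exact h
  have hlog := Complex.norm_log_one_add_half_le_self (z := η) (by linarith)
  have h0 : 1 + η ≠ 0 := by
    intro h0
    have : η = -1 := by linear_combination h0
    rw [this] at hn
    norm_num at hn
    linarith
  have hnn := norm_nonneg η
  have hre : |Real.log ‖1 + η‖| ≤ Real.log 2 * ε := by
    rw [← Complex.log_re]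
    have h2 := Real.log_two_gt_d9
    refine (Complex.abs_re_le_norm _).trans (hlog.trans ?_)
    nlinarith
  have him : |(1 + η).arg| ≤ ε := by
    rw [← Complex.log_im]
    refine (Complex.abs_im_le_norm _).trans (hlog.trans ?_)
    linarith
  have hpos : 0 < ‖1 + η‖ := norm_pos_iff.2 h0
  have habs := abs_le.1 hre
  rw [hvu, Real.rpow_def_of_pos two_pos, Real.rpow_def_of_pos two_pos]
  refine ⟨?_, ?_, him⟩
  · rw [← Real.le_log_iff_exp_le hpos]; linarith [habs.1]
  · rw [← Real.log_le_iff_le_exp hpos]; exact habs.2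

/-- The threshold separates the two cases: |w| ≤ 2T²W < T if Z = 0, and |w| ≥ |Z|/2 ≥ 1/(2W) ≥ T
otherwise. In the second case the tolerance ε is split evenly between the perturbation and the
oracle. -/
theorem isApproxSolution_cutoff {ε T W : ℝ} {Z Z' w : ℂ} (hε : 0 < ε) (hε1 : ε < 1) (hT : 0 < T)
    (hW : 1 ≤ W) (hTW : T * (8 * W ^ 2) ≤ ε) (hZ : Z ≠ 0 → 1 ≤ ‖Z‖ * W)
    (hdiff : ‖Z' - Z‖ ≤ T ^ 2 * W) (hw : IsApproxSolution (ε / 2) Z' w) :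
    IsApproxSolution ε Z (if ‖w‖ < T then 0 else w) := by
  have hWW : W ≤ W ^ 2 := by nlinarith
  have hT8W : T * (8 * W) ≤ ε := le_trans (by gcongr) hTW
  by_cases hZ0 : Z = 0
  · subst hZ0
    refine ⟨fun _ => if_pos ?_, fun h => absurd rfl h⟩
    rw [sub_zero] at hdiff
    by_cases hZ' : Z' = 0
    · rw [hw.1 hZ', norm_zero]; exact hT
    · have h1 := (hw.2 hZ').2.1
      have h2 : (2 : ℝ) ^ (ε / 2) ≤ 2 := by
        conv_rhs => rw [← Real.rpow_one 2]
        exact Real.rpow_le_rpow_of_exponent_le (by norm_num) (by linarith)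
      rw [norm_div, div_le_iff₀ (norm_pos_iff.2 hZ')] at h1
      have h3 : ‖w‖ ≤ 2 * ‖Z'‖ := h1.trans (by gcongr)
      nlinarith
  · have hZW := hZ hZ0
    have hT1 : T ≤ 1 := by nlinarith
    have hrel : ‖Z' - Z‖ ≤ ε / 2 / 4 * ‖Z‖ := by
      refine hdiff.trans ?_
      have h1 : T ^ 2 * W ≤ T ^ 2 * W * (‖Z‖ * W) := le_mul_of_one_le_right (by positivity) hZW
      have h2 : T * W ^ 2 ≤ ε / 8 := by linarith
      have h3 : T * (T * W ^ 2) ≤ 1 * (ε / 8) :=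
        mul_le_mul hT1 h2 (by positivity) (by norm_num)
      calc _ ≤ _ := h1
        _ = T * (T * W ^ 2) * ‖Z‖ := by ring
        _ ≤ 1 * (ε / 8) * ‖Z‖ := by gcongr
        _ = _ := by ring
    have happ := (isApproxSolution_of_norm_sub_le (by linarith) hZ0 hrel).trans
      (by linarith) hw hZ0
    rw [add_halves] at happ
    have h1 := (happ.2 hZ0).1
    rw [norm_div, le_div_iff₀ (norm_pos_iff.2 hZ0)] at h1
    have h2 : 1 / 2 * ‖Z‖ ≤ ‖w‖ :=
      le_trans (mul_le_mul_of_nonneg_right (two_rpow_neg_ge_half hε1.le) (norm_nonneg _)) h1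
    have h3 : T ≤ ‖w‖ := by
      refine le_trans ?_ h2
      have h4 : T * (8 * W) ≤ ‖Z‖ * W := by linarith
      have h5 : T * 8 ≤ ‖Z‖ := by
        refine le_of_mul_le_mul_right ?_ (show 0 < W by linarith)
        linarith
      linarith
    rw [if_neg (not_lt.2 h3)]
    exact happ

/-! ### AP-reductions with a single oracle call -/

theorem polyBound_C_mul_X_one (a : ℝ) (n : ℕ) (ε : ℝ) :
    polyBound (MvPolynomial.C a * MvPolynomial.X 1) n ε = a * (1 / ε) := by
  simp [polyBound]

theorem Prog.init_eq (N : Prog) (x : List Bool) (ε : ℝ) :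
    N.init x ε = ⟨[N], fiveStacks x [] [] [] [], fiveRegs ε 0 0 0 0, []⟩ := by
  have h1 : (fun _ => [] : ℕ → List Bool) = fiveStacks [] [] [] [] [] := by
    funext i; rcases i with _ | _ | _ | _ | _ | _ <;> rfl
  have h2 : (fun _ => 0 : ℕ → ℂ) = fiveRegs 0 0 0 0 0 := by
    funext i; rcases i with _ | _ | _ | _ | _ | _ <;> rfl
  rw [Prog.init, h1, h2, update_fiveStacks_zero, update_fiveRegs_zero]

/-- It suffices to ask the oracle once, about an instance whose approximate solutions can be
turned into approximate solutions of the given instance. -/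
theorem apReducible_of_single_query {F G : CountingProblem} (N : Prog) (a : ℝ)
    (q : MvPolynomial (Fin 2) ℝ)
    (h : ∀ (x : F.Inst) (ε : ℝ), 0 < ε → ε < 1 → ∃ (y : G.Inst) (δ : ℝ) (conf : ℂ → Config),
      0 < δ ∧ δ < 1 ∧ 1 / δ ≤ a * (1 / ε) ∧
      (∀ z, (conf z).todo = [] ∧ (conf z).calls = [(G.encode y, (δ : ℂ))]) ∧
      (∀ z, IsApproxSolution δ (G.value y) z → IsApproxSolution ε (F.value x) (conf z).output) ∧
      ∀ M : RandomizedMap,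
        (N.init (F.encode x) ε).run M ⌊polyBound q (F.encode x).length ε⌋₊ =
          (M (G.encode y) δ).bind fun z => PMF.pure (conf z)) :
    APReducible F G := by
  refine ⟨N, MvPolynomial.C a * MvPolynomial.X 1, q, fun M hM => ⟨fun x ε hε hε1 => ?_,
    fun x ε hε hε1 c hc => ?_⟩⟩
  · obtain ⟨y, δ, conf, hδ, hδ1, -, -, happ, hrun⟩ := h x ε hε hε1
    refine (hM y δ hδ hδ1).trans ?_
    beta_reduce
    rw [hrun, PMF.map_bind]
    simp only [PMF.pure_map]
    rw [show (fun z => PMF.pure (conf z).output) = PMF.pure ∘ fun z => (conf z).output from rfl,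
      PMF.bind_pure_comp, PMF.toOuterMeasure_map_apply]
    -- Every successful oracle answer leads to a successful output, so the probability 3/4 carries
    -- over without amplification.
    exact MeasureTheory.measure_mono fun z hz => happ z hz
  · obtain ⟨y, δ, conf, hδ, hδ1, hδε, hconf, -, hrun⟩ := h x ε hε hε1
    rw [hrun, PMF.mem_support_bind_iff] at hc
    obtain ⟨z, -, hc⟩ := hc
    rw [PMF.support_pure, Set.mem_singleton_iff] at hc
    subst hc
    refine ⟨(hconf z).1, fun call hcall => ⟨δ, ?_, hδ, hδ1, ?_⟩⟩
    · rw [(hconf z).2, List.mem_singleton] at hcall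
      rw [hcall]
    · rwa [polyBound_C_mul_X_one]

theorem apReducible_sharpCSPAlg_of_subset {F G : Set Constraint} (h : F ⊆ G) :
    APReducible (sharpCSPAlg F) (sharpCSPAlg G) := by
  refine apReducible_of_single_query (.query 0 0 0) 1 1 fun x ε hε hε1 =>
    ⟨⟨x.1, fun v hv => h (x.2 v hv)⟩, ε,
      fun z => ⟨[], fiveStacks (encFrame x.1) [] [] [] [], fiveRegs z 0 0 0 0,
        [(encFrame x.1, (ε : ℂ))]⟩, hε, hε1, by rw [one_mul], fun z => ⟨rfl, rfl⟩,
      fun z hz => hz, fun M => ?_⟩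
  have hq : ⌊polyBound 1 (encFrame x.1).length ε⌋₊ = 1 + 0 := by simp [polyBound]
  change Config.run M ⌊polyBound 1 (encFrame x.1).length ε⌋₊ (Prog.init _ (encFrame x.1) ε) = _
  rw [hq, Prog.init_eq, run_query]
  simp only [fiveStacks_zero, fiveRegs_zero, Complex.ofReal_re, update_fiveRegs_zero]
  rfl

/-! ### Eliminating unary constraints with zeros -/

/-- This is what fixes `N`: the exponent 2^N exceeds 2^k by enough to absorb 8W² = 2^(3 +
2·2^(4ℓ+1)). -/
theorem half_pow_mul_le {ε : ℝ} {k N ℓ : ℕ} (hk : (1 / 2 : ℝ) ^ 2 ^ k ≤ ε / 2)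
    (hN : N = k + 8 + 8 * ℓ) :
    (1 / 2 : ℝ) ^ 2 ^ N * (8 * (2 ^ 2 ^ (4 * ℓ + 1)) ^ 2) ≤ ε := by
  have hexp : 2 ^ k + (3 + 2 ^ (4 * ℓ + 1) * 2) ≤ 2 ^ N := by
    have h1 : 1 ≤ 2 ^ k := Nat.one_le_two_pow
    have h2 : 2 ^ N = 2 ^ k * (2 ^ (4 * ℓ + 1) * (2 ^ (4 * ℓ) * 2 ^ 7)) := by
      rw [hN]; ring
    have h3 : 1 ≤ 2 ^ (4 * ℓ) := Nat.one_le_two_pow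
    have h4 : 2 ≤ 2 ^ (4 * ℓ + 1) := by rw [pow_succ]; omega
    have h5 : 2 ^ (4 * ℓ + 1) * 128 ≤ 2 ^ (4 * ℓ + 1) * (2 ^ (4 * ℓ) * 2 ^ 7) :=
      Nat.mul_le_mul_left _ (by omega)
    rw [h2]
    refine le_trans ?_ (Nat.mul_le_mul_left _ h5)
    nlinarith
  have h0 : 0 ≤ ε := by
    have : (0 : ℝ) < (1 / 2) ^ 2 ^ k := by positivity
    linarith
  calc (1 / 2 : ℝ) ^ 2 ^ N * (8 * (2 ^ 2 ^ (4 * ℓ + 1)) ^ 2)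
      ≤ (1 / 2 : ℝ) ^ (2 ^ k + (3 + 2 ^ (4 * ℓ + 1) * 2)) * (8 * (2 ^ 2 ^ (4 * ℓ + 1)) ^ 2) :=
        mul_le_mul_of_nonneg_right (pow_le_pow_of_le_one (by norm_num) (by norm_num) hexp)
          (by positivity)
    _ = (1 / 2 : ℝ) ^ 2 ^ k * ((1 / 2) ^ (3 + 2 ^ (4 * ℓ + 1) * 2) *
          2 ^ (3 + 2 ^ (4 * ℓ + 1) * 2)) := by
        rw [pow_add _ (2 ^ k), pow_add (2 : ℝ), pow_mul (2 : ℝ)]; norm_num; ring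
    _ = (1 / 2 : ℝ) ^ 2 ^ k := by rw [← mul_pow]; norm_num
    _ ≤ ε := by linarith

/-- A bound for the number of steps of `perturbAndQuery`. -/
noncomputable def stepBound : MvPolynomial (Fin 2) ℝ :=
  -- The inner sum bounds `N = k + 8 + 8ℓ`, using k ≤ 2/ε + 1.
  7 * ((24 * (2 * MvPolynomial.X 1 + 9 + 8 * MvPolynomial.X 0) +
    ((2 * (encLine (.root [-1, 4] 0 0 1)).length + 40 : ℕ) : MvPolynomial (Fin 2) ℝ)) *
      MvPolynomial.X 0) + 4 * (2 * MvPolynomial.X 1 + 1) + 46 * MvPolynomial.X 0 + 105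

theorem le_floor_stepBound {ε : ℝ} {k N ℓ : ℕ} (hk : (k : ℝ) ≤ 1 / (ε / 2) + 1)
    (hN : N = k + 8 + 8 * ℓ) :
    7 * (perturbCost N * ℓ) + 4 * k + 46 * ℓ + 100 + 5 ≤ ⌊polyBound stepBound ℓ ε⌋₊ := by
  rw [one_div_div] at hk
  have hk' : (k : ℝ) ≤ 2 * (1 / ε) + 1 := by rwa [mul_one_div]
  refine Nat.le_floor ?_
  unfold polyBound stepBound perturbCost
  simp only [map_add, map_mul, map_natCast, map_ofNat, map_one, MvPolynomial.eval_X,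
    Matrix.cons_val_zero, Matrix.cons_val_one]
  rw [hN]
  push_cast
  have hℓ : (0 : ℝ) ≤ ℓ := Nat.cast_nonneg ℓ
  have h := mul_le_mul_of_nonneg_right hk' hℓ
  nlinarith

theorem apReducible_star_plus (F : Set Constraint) :
    APReducible (sharpCSPStarAlg F) (sharpCSPPlusAlg F) := by
  refine apReducible_of_single_query perturbAndQuery 2 stepBound fun x ε hε hε1 => ?_
  obtain ⟨c, hc⟩ := x
  obtain ⟨k, hk, hlt, hkle⟩ := exists_half_pow_le (half_pos hε)
  obtain ⟨N, hN⟩ : ∃ N, N = k + 8 + 8 * (encFrame c).length := ⟨_, rfl⟩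
  obtain ⟨t, ht, hrun⟩ := exists_runs_prepare hε hk hlt c hN
  obtain ⟨hlow, hdiff, hval⟩ := c.perturb_bounds rfl N
  have hTW := half_pow_mul_le hk hN
  have hsq : (1 / 4 : ℝ) ^ 2 ^ N = ((1 / 2) ^ 2 ^ N) ^ 2 := by
    rw [← pow_mul, mul_comm, pow_mul]; norm_num
  set W : ℝ := 2 ^ 2 ^ (4 * (encFrame c).length + 1)
  set T : ℝ := (1 / 2) ^ 2 ^ N
  have hW1 : 1 ≤ W := one_le_pow₀ (by norm_num)
  have hT0 : 0 < T := by positivity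
  have hy : ∀ v ∈ (c.perturb N).nodes,
      v.constraint ∈ F ∪ (unaryConstraints ∩ nonzeroConstraints) := by
    intro v hv
    obtain ⟨v, hvc, rfl⟩ := List.mem_map.1 hv
    refine NodeCode.constraint_perturb_mem (hc v hvc) fun y h0 => ?_
    -- A zero value becomes the nonzero perturbation. A nonzero value could be cancelled only if its
    -- modulus were T², but it is at least 1/W, and T²W < 1.
    have hne : (v.table y).value ≠ 0 := by
      intro h
      rw [h, zero_add] at h0
      exact absurd h0 (pow_ne_zero _ (by norm_num))
    have h1 := hval v hvc y hne
    have h2 : ‖(v.table y).value‖ = T ^ 2 := by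
      rw [eq_neg_of_add_eq_zero_left h0, norm_neg, norm_pow, ← hsq]
      norm_num
    rw [h2] at h1
    have h3 : T * W ≤ T * (8 * W ^ 2) := by gcongr; nlinarith
    have h4 : T ≤ T * W := le_mul_of_one_le_right hT0.le hW1
    have h5 : T * (T * W) < 1 * 1 :=
      mul_lt_mul'' (by linarith) (by linarith) hT0.le (by positivity)
    linarith
  refine ⟨⟨c.perturb N, hy⟩, ε / 2,
    fun z => ⟨[], fiveStacks (encFrame (c.perturb N)) [] (List.replicate N true) [] [],
      fiveRegs (if ‖z‖ < T then 0 else z) 1 2 ((ε / 2 : ℝ) : ℂ) ((1 / 2) ^ 2 ^ N),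
      [(encFrame (c.perturb N), ((ε / 2 : ℝ) : ℂ))]⟩,
    by linarith, by linarith, by rw [one_div_div, mul_one_div], fun z => ⟨rfl, rfl⟩,
    fun z hz => ?_, fun M => ?_⟩
  · exact isApproxSolution_cutoff hε hε1 hT0 hW1 hTW hlow (by rw [← hsq]; exact hdiff) hz
  · change Config.run M ⌊polyBound stepBound (encFrame c).length ε⌋₊
      (Prog.init _ (encFrame c) ε) = _
    rw [Prog.init_eq]
    exact run_perturbAndQuery hrun M _ ((Nat.add_le_add_right ht 5).trans
      (le_floor_stepBound hkle hN))

theorem mainTheorem3 (F : Set Constraint) :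
    APEquivalent (sharpCSPStarAlg F) (sharpCSPPlusAlg F) :=
  ⟨apReducible_star_plus F,
    apReducible_sharpCSPAlg_of_subset (Set.union_subset_union_right F Set.inter_subset_left)⟩
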